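/- Let $\mathbb F_q$ be a finite field, $g\in\mathbb F_q$ a non-zero element of multiplicative order $z$, $\mathbb E=\{g^i\mid 1\le i\le z\}$, $\mathbb E_0=\mathbb E\cup\{0\}$, $Q=\log_2 q$, $Z=\log_2 z$, and let $h(x)=-x\log_2x-(1-x)\log_2(1-x)$ be the binary entropy function (with $0\log_2 0=0$). **Instance and parameters.** For each $n\in\mathbb N$ let $k,\ell,v_0,v_1,v_2,\varepsilon_1,\varepsilon_2\in\mathbb N$ (depending on $n$) satisfy $v_i=v_{i-1}/2+\varepsilon_i$ and $v_{i-1}+\varepsilon_i\le k+\ell$ for $i=1,2$, with $k+\ell$ and $v_2$ even, and assume $-1\in\mathbb E$ or $\varepsilon_1=\varepsilon_2=0$. A small instance consists of $A\in\mathbb F_q^{(k+\ell)\times\ell}$ and $s\in\mathbb F_q^\ell$; one looks for $e\in\mathbb E_0^{k+\ell}$ of Hamming weight $v_0$ with $eA=s$. Let $\mathcal S_i$ be the set of vectors in $\mathbb E_0^{k+\ell}$ of Hamming weight $v_i$. For $i=0,1$ let $r_i$ be the number of representations of a vector $e\in\mathcal S_i$ as $e=x_1+x_2$ with $x_1,x_2\in\mathcal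 S_{i+1}$ such that $x_1$ and $x_2$ cancel at every position where both are non-zero (this number does not depend on $e$), and let $u_i=\lfloor\log_q r_i\rfloor$. **Algorithm.** Merging two lists on the first $u$ positions with target $t$ and weight $w$ means: store the first list in a hash table, look up each element of the second list, process each pair $(x_1,x_2)$ for which $(x_1+x_2)A$ agrees with $t$ on the first $u$ positions (on all $\ell$ positions if $u\geq\ell$), and collect, without repetition, those sums $x_1+x_2$ that lie in $\mathbb E_0^{k+\ell}$ and have weight $w$. Inserting one vector, looking up one vector and processing one pair cost one step each. The restricted BJMM(2) algorithm 1. generates the two base lists of all vectors in $\mathbb E_0^{k+\ell}$ of weight $v_2/2$ supported on the first, respectively the second, half of the positions (one step per vector); 2. merges them on $u_1$ positions with weight $v_2$, once with target $0$ and once with target $s$, giving lists $C_0$ and $C_s$; 3. merges $C_0$ with $C_0$ with target $0$, and $C_0$ with $C_s$ with target $s$, on $u_0$ positions with weight $v_1$, giving $D_0$ and $D_s$; 4. merges $D_0$ with $D_s$ on all $\ell$ positions with target $s$ and weight $v_0$. Its enumeration cost is the expected total number of steps for uniformly random $A$. **Theorem.** Let $R,L,V_0,E_1,E_2\ge 0$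 be real numbers, and put, for $i=1,2$, $$V_i=\tfrac{V_{i-1}}2+E_i,\qquad \Sigma_i=(R+L)\,h\!\left(\tfrac{V_i}{R+L}\right)+ZV_i,$$ and, for $i=0,1$, $$U_i=V_i+(R+L-V_i)\,h\!\left(\tfrac{E_{i+1}}{R+L-V_i}\right)+ZE_{i+1}$$ (a product $x\,h(y/x)$ with $x=0$ is read as $0$). Assume $V_0+E_1\le R+L$, $V_1+E_2\le R+L$, $U_1\le U_0\le QL$, and that $-1\in\mathbb E$ or $E_1=E_2=0$. Then there are integer parameters as above with $k/n\to R$, $\ell/n\to L$, $v_i/n\to V_i$ and $\varepsilon_i/n\to E_i$ as $n\to\infty$, and for all such parameters $$\tfrac1n\log_2|\mathcal S_i|\to\Sigma_i\ (i=1,2),\qquad Q\,\tfrac{u_i}{n}\to U_i\ (i=0,1),$$ and, for every choice of $s=s(n)\in\mathbb F_q^{\ell}$, the enumeration cost of the restricted BJMM(2) algorithm is $2^{n(C+o(1))}$ with $$C=\max\left\{\tfrac{\Sigma_2}{2},\ \Sigma_2-U_1,\ 2\Sigma_2-U_1-U_0,\ 2\Sigma_1-U_0-QL\right\}.$$ In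 particular $V_i,E_i$ may be optimized under the stated constraints. -/

import Mathlib

open Filter Topology

namespace RestrictedBJMM

/-! ### The restricted error set and the search spaces -/

/-- The error set `𝔼 = {g ^ i | 1 ≤ i ≤ z}`, where `z` is the order of `g`. -/
noncomputable def errorSet {F : Type*} [Field F] [DecidableEq F] (g : F) : Finset F :=
  (Finset.Icc 1 (orderOf g)).image (fun i => g ^ i)

/-- The well-formed vectors of weight `w`: the vectors of length `m` with entries in
`𝔼₀ = 𝔼 ∪ {0}` and Hamming weight `w`. -/
noncomputable def wellFormed {F : Type*} [Field F] [Fintype F] [DecidableEq F] (g : F) (m w : ℕ) :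
    Finset (Fin m → F) :=
  Finset.univ.filter
    (fun x => (∀ j, x j = 0 ∨ x j ∈ errorSet g) ∧ hammingNorm x = w)

/-- The representations `e = x₁ + x₂` of `e` by two well-formed vectors of weight `w'` whose
overlapping positions cancel out, each one given by its first summand `x₁`. -/
noncomputable def representations {F : Type*} [Field F] [Fintype F] [DecidableEq F] (g : F) {m : ℕ}
    (w' : ℕ) (e : Fin m → F) : Finset (Fin m → F) :=
  (wellFormed g m w').filter
    (fun x₁ => e - x₁ ∈ wellFormed g m w' ∧
      ∀ j, x₁ j ≠ 0 → (e - x₁) j ≠ 0 → x₁ j + (e - x₁) j = 0)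

/-- The number `r` of representations of a well-formed vector of weight `w` by vectors of
weight `w'`.  (The number is the same for all well-formed vectors of weight `w`, so that the
supremum is this common value.) -/
noncomputable def numRepresentations {F : Type*} [Field F] [Fintype F] [DecidableEq F] (g : F)
    (m w w' : ℕ) : ℕ :=
  (wellFormed g m w).sup (fun e => (representations g w' e).card)

/-! ### Parameters -/

/-- The integer parameters of a run: the small instance has length `k + ℓ`, syndromes of
length `ℓ` and weight `v₀`; the vectors on level `i` have weight `vᵢ`, and `εᵢ` is the number of
overlapping positions of two vectors of level `i` that are added. -/
structure Params where
  k : ℕ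
  ℓ : ℕ
  v₀ : ℕ
  v₁ : ℕ
  v₂ : ℕ
  ε₁ : ℕ
  ε₂ : ℕ

/-- The parameters fit together: `vᵢ = vᵢ₋₁ / 2 + εᵢ` without rounding, the `εᵢ₊₁` overlapping
positions are chosen among the `k + ℓ - vᵢ` zero positions, level-2 vectors can be split into two
halves of length `(k + ℓ) / 2` and weight `v₂ / 2`, and overlapping entries can cancel. -/
structure Params.Admissible {F : Type*} [Field F] [DecidableEq F] (p : Params) (g : F) :
    Prop where
  weight₁ : 2 * p.v₁ = p.v₀ + 2 * p.ε₁
  weight₂ : 2 * p.v₂ = p.v₁ + 2 * p.ε₂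
  room₁ : p.v₀ + p.ε₁ ≤ p.k + p.ℓ
  room₂ : p.v₁ + p.ε₂ ≤ p.k + p.ℓ
  even_length : Even (p.k + p.ℓ)
  even_weight : Even p.v₂
  cancel : -1 ∈ errorSet g ∨ (p.ε₁ = 0 ∧ p.ε₂ = 0)

/-- The number `u₀ = ⌊log_q r₀⌋` of positions on which level-1 lists are merged. -/
noncomputable def Params.u₀ {F : Type*} [Field F] [Fintype F] [DecidableEq F] (p : Params) (g : F) : ℕ :=
  Nat.log (Fintype.card F) (numRepresentations g (p.k + p.ℓ) p.v₀ p.v₁)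

/-- The number `u₁ = ⌊log_q r₁⌋` of positions on which level-2 lists are merged. -/
noncomputable def Params.u₁ {F : Type*} [Field F] [Fintype F] [DecidableEq F] (p : Params) (g : F) : ℕ :=
  Nat.log (Fintype.card F) (numRepresentations g (p.k + p.ℓ) p.v₁ p.v₂)

/-- The relative parameters of a sequence of parameters indexed by the code length `n`. -/
structure HasRates (p : ℕ → Params) (R L V₀ V₁ V₂ E₁ E₂ : ℝ) : Prop where
  k : Tendsto (fun n => ((p n).k : ℝ) / n) atTop (𝓝 R)
  ℓ : Tendsto (fun n => ((p n).ℓ : ℝ) / n) atTop (𝓝 L)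
  v₀ : Tendsto (fun n => ((p n).v₀ : ℝ) / n) atTop (𝓝 V₀)
  v₁ : Tendsto (fun n => ((p n).v₁ : ℝ) / n) atTop (𝓝 V₁)
  v₂ : Tendsto (fun n => ((p n).v₂ : ℝ) / n) atTop (𝓝 V₂)
  ε₁ : Tendsto (fun n => ((p n).ε₁ : ℝ) / n) atTop (𝓝 E₁)
  ε₂ : Tendsto (fun n => ((p n).ε₂ : ℝ) / n) atTop (𝓝 E₂)

/-! ### The algorithm, with a count of its steps

One step is one of the following operations: generating one vector of a base list, inserting one
vector into a hash table, looking up one key in a hash table, or processing one colliding pair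
(adding the two vectors, testing whether the sum is well-formed, storing it if it is new). -/

/-- A result together with the number of steps spent on it. -/
structure Timed (α : Type*) where
  val : α
  steps : ℕ

/-- Store the vectors of a list in a hash table, indexed by their keys. -/
def buildTable {α κ : Type*} [DecidableEq κ] (key : α → κ) : List α → Timed (κ → List α)
  | [] => ⟨fun _ => [], 0⟩
  | x :: xs =>
    let T := buildTable key xs
    ⟨Function.update T.val (key x) (x :: T.val (key x)), T.steps + 1⟩

/-- Process the pairs `(x, y)` for the vectors `x` of a bucket: add `x + y` to the resulting
list if it is well-formed and not yet there. -/
def processBucket {α : Type*} [Add α] [DecidableEq α] (good : Finset α) (y : α) :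
    List α → Timed (List α) → Timed (List α)
  | [], acc => acc
  | x :: xs, acc =>
    processBucket good y xs
      ⟨if x + y ∈ good then acc.val.insert (x + y) else acc.val, acc.steps + 1⟩

/-- Look up each vector of a list in the hash table and process the bucket that is found. -/
def probe {α κ : Type*} [Add α] [DecidableEq α] (good : Finset α) (key : α → κ)
    (T : κ → List α) : List α → Timed (List α) → Timed (List α)
  | [], acc => acc
  | y :: ys, acc =>
    probe good key T ys (processBucket good y (T (key y)) ⟨acc.val, acc.steps + 1⟩)

/-- Merge two lists on the first `u` positions with target `t`: find all pairs `(x₁, x₂)` such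
that `(x₁ + x₂) A` agrees with `t` on the first `u` positions, and collect the sums `x₁ + x₂` that
are well-formed of weight `w`. -/
noncomputable def merge {F : Type*} [Field F] [Fintype F] [DecidableEq F] (g : F) {m ℓ : ℕ}
    (A : Matrix (Fin m) (Fin ℓ) F) (u : ℕ) (t : Fin ℓ → F) (w : ℕ)
    (L₁ L₂ : List (Fin m → F)) : Timed (List (Fin m → F)) :=
  let T := buildTable
    (fun x (j : Fin ℓ) => if j.val < u then Matrix.vecMul x A j else 0) L₁
  probe (wellFormed g m w)
    (fun x (j : Fin ℓ) => if j.val < u then t j - Matrix.vecMul x A j else 0)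
    T.val L₂ ⟨[], T.steps⟩

/-- Generate the first base list: all vectors with entries in `𝔼₀` and weight `w` that are
supported on the first half of the positions. -/
noncomputable def leftBase {F : Type*} [Field F] [Fintype F] [DecidableEq F] (g : F)
    (m w : ℕ) : Timed (List (Fin m → F)) :=
  let B := ((wellFormed g m w).filter (fun x => ∀ j, x j ≠ 0 → 2 * j.val < m)).toList
  ⟨B, B.length⟩

/-- Generate the second base list: all vectors with entries in `𝔼₀` and weight `w` that are
supported on the second half of the positions. -/
noncomputable def rightBase {F : Type*} [Field F] [Fintype F] [DecidableEq F] (g : F)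
    (m w : ℕ) : Timed (List (Fin m → F)) :=
  let B := ((wellFormed g m w).filter (fun x => ∀ j, x j ≠ 0 → m ≤ 2 * j.val)).toList
  ⟨B, B.length⟩

/-- The restricted BJMM(2) algorithm for the small instance `e A = s` of weight `v₀`: a
concatenation merge of the base lists on `u₁` positions (with targets `0` and `s`), a first
representation merge on `u₀` positions (with targets `0 = 0 + 0` and `s = 0 + s`), and a final
representation merge on all `ℓ` positions with target `s`. -/
noncomputable def bjmm2 {F : Type*} [Field F] [Fintype F] [DecidableEq F] (g : F) (p : Params)
    (A : Matrix (Fin (p.k + p.ℓ)) (Fin p.ℓ) F) (s : Fin p.ℓ → F) :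
    Timed (List (Fin (p.k + p.ℓ) → F)) :=
  let B₁ := leftBase g (p.k + p.ℓ) (p.v₂ / 2)
  let B₂ := rightBase g (p.k + p.ℓ) (p.v₂ / 2)
  let C₀ := merge g A (p.u₁ g) 0 p.v₂ B₁.val B₂.val
  let Cₛ := merge g A (p.u₁ g) s p.v₂ B₁.val B₂.val
  let D₀ := merge g A (p.u₀ g) 0 p.v₁ C₀.val C₀.val
  let Dₛ := merge g A (p.u₀ g) s p.v₁ C₀.val Cₛ.val
  let S := merge g A p.ℓ s p.v₀ D₀.val Dₛ.val
  ⟨S.val, B₁.steps + B₂.steps + C₀.steps + Cₛ.steps + D₀.steps + Dₛ.steps + S.steps⟩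

/-- The enumeration cost: the expected number of steps for a uniformly random matrix `A`. -/
noncomputable def enumCost {F : Type*} [Field F] [Fintype F] [DecidableEq F] (g : F)
    (p : Params) (s : Fin p.ℓ → F) : ℝ :=
  (∑ A : Matrix (Fin (p.k + p.ℓ)) (Fin p.ℓ) F, ((bjmm2 g p A s).steps : ℝ)) /
    (Fintype.card (Matrix (Fin (p.k + p.ℓ)) (Fin p.ℓ) F) : ℝ)

/-! ### Exponents -/

/-- The binary entropy function, with logarithms to base 2. -/
noncomputable def h (x : ℝ) : ℝ := Real.binEntropy x / Real.log 2

/-- `Σ = (R + L) h(V / (R + L)) + Z V`, where `M` stands for `R + L`. -/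
noncomputable def sizeExponent (Z M V : ℝ) : ℝ := M * h (V / M) + Z * V

/-- `U = V + (R + L - V) h(E / (R + L - V)) + Z E`, where `M` stands for `R + L`. -/
noncomputable def repExponent (Z M V E : ℝ) : ℝ := V + (M - V) * h (E / (M - V)) + Z * E

end RestrictedBJMM

set_option linter.unusedSectionVars false

namespace RestrictedBJMM

/-! ### Exponential growth rates -/

/-! Stirling's formula gives a binomial coefficient the entropy function as exponent. Explicit
counts then yield the exponents of the sets of well-formed vectors and of the representation numbers
`r`, hence of `q ^ u` with `u = ⌊log_q r⌋`, which lies between `r / q` and `r`. Exponents add under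
products and become maxima under sums, so it suffices to enclose the expected cost between explicit
expressions with the same exponent.

The cost is a sum of list sizes and collision counts (`bjmm2_steps`). For a uniformly random matrix,
the images of linearly independent vectors are independent and uniform (`prob_agrees`). In a
representation merge, a colliding pair `(x, y)` forces one condition on `x` and one on `x + y`, so
an independent pair contributes the product of two match probabilities. A dependent pair has the
form `(x, c • x)`; there are at most `q` of these per `x`, and they are absorbed by the size of the
preceding list. This is the upper bound `enumCost_le`.

For the lower bound, only vectors with prescribed weights in the two halves are counted; this loses
a subexponential factor. Every level-2 vector with equal half weights and the right image is found,
which settles all terms but the last. A level-1 vector is found only if one of its representations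
survives the merge on `u₁` positions. The expected number of survivors is merely subexponential, so
a second moment argument, carried out jointly for both vectors of a final pair and together with the
conditions on their images, shows that the survival of both costs only a subexponential factor
(`prob_exists_pair_ge`, `le_enumCost_finalCollisions`). -/

/-- The sequence `f` is eventually positive and grows like `2 ^ (n (α + o(1)))`. -/
def GrowthRate (f : ℕ → ℝ) (α : ℝ) : Prop :=
  (∀ᶠ n in atTop, 0 < f n) ∧ Tendsto (fun n : ℕ => Real.logb 2 (f n) / n) atTop (𝓝 α)

namespace GrowthRate

variable {f g k : ℕ → ℝ} {α β : ℝ}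

theorem of_eventuallyEq (hf : GrowthRate f α) (h : ∀ᶠ n in atTop, f n = g n) :
    GrowthRate g α := by
  refine ⟨?_, hf.2.congr' ?_⟩
  · filter_upwards [hf.1, h] with n h1 h2
    rwa [← h2]
  · filter_upwards [h] with n h2
    rw [h2]

theorem mul (hf : GrowthRate f α) (hg : GrowthRate g β) :
    GrowthRate (fun n => f n * g n) (α + β) := by
  refine ⟨?_, (hf.2.add hg.2).congr' ?_⟩
  · filter_upwards [hf.1, hg.1] with n h1 h2
    positivity
  · filter_upwards [hf.1, hg.1] with n h1 h2
    rw [Real.logb_mul h1.ne' h2.ne', add_div]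

theorem inv (hf : GrowthRate f α) : GrowthRate (fun n => (f n)⁻¹) (-α) := by
  refine ⟨?_, hf.2.neg.congr fun n => ?_⟩
  · filter_upwards [hf.1] with n h1
    positivity
  · rw [Real.logb_inv, neg_div]

theorem div (hf : GrowthRate f α) (hg : GrowthRate g β) :
    GrowthRate (fun n => f n / g n) (α - β) := by
  simpa only [div_eq_mul_inv, sub_eq_add_neg] using hf.mul hg.inv

theorem const {c : ℝ} (hc : 0 < c) : GrowthRate (fun _ => c) 0 :=
  ⟨Eventually.of_forall fun _ => hc,
    tendsto_const_nhds.div_atTop tendsto_natCast_atTop_atTop⟩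

theorem const_mul {c : ℝ} (hc : 0 < c) (hf : GrowthRate f α) :
    GrowthRate (fun n => c * f n) α := by
  simpa using (const hc).mul hf

theorem two_rpow (c : ℝ) : GrowthRate (fun n => (2 : ℝ) ^ (n * c)) c := by
  refine ⟨Eventually.of_forall fun _ => by positivity, tendsto_const_nhds.congr' ?_⟩
  filter_upwards [eventually_gt_atTop 0] with n hn
  rw [Real.logb_rpow (by norm_num) (by norm_num)]
  field_simp

theorem squeeze (hf : GrowthRate f α) (hk : GrowthRate k α) (h₁ : ∀ᶠ n in atTop, f n ≤ g n)
    (h₂ : ∀ᶠ n in atTop, g n ≤ k n) : GrowthRate g α := by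
  refine ⟨?_, tendsto_of_tendsto_of_tendsto_of_le_of_le' hf.2 hk.2 ?_ ?_⟩
  · filter_upwards [hf.1, h₁] with n h1 h2
    linarith
  · filter_upwards [hf.1, h₁] with n h1 h2
    gcongr
    exact one_lt_two
  · filter_upwards [hf.1, h₁, h₂] with n h1 h2 h3
    have : 0 < g n := by linarith
    gcongr
    exact one_lt_two

theorem max (hf : GrowthRate f α) (hg : GrowthRate g β) :
    GrowthRate (fun n => Max.max (f n) (g n)) (Max.max α β) := by
  refine ⟨?_, (hf.2.max hg.2).congr' ?_⟩
  · filter_upwards [hf.1] with n h1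
    exact lt_max_of_lt_left h1
  · filter_upwards [hf.1, hg.1] with n h1 h2
    rw [max_div_div_right (Nat.cast_nonneg n)]
    congr 1
    rcases le_total (f n) (g n) with h | h
    · rw [max_eq_right h, max_eq_right (Real.logb_le_logb_of_le one_lt_two h1 h)]
    · rw [max_eq_left h, max_eq_left (Real.logb_le_logb_of_le one_lt_two h2 h)]

/-- The sum of positive terms lies between their maximum and twice their maximum. -/
theorem add (hf : GrowthRate f α) (hg : GrowthRate g β) :
    GrowthRate (fun n => f n + g n) (Max.max α β) := by
  refine (hf.max hg).squeeze ((hf.max hg).const_mul two_pos) ?_ ?_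
  · filter_upwards [hf.1, hg.1] with n h1 h2
    exact max_le (by linarith) (by linarith)
  · filter_upwards with n
    linarith [le_max_left (f n) (g n), le_max_right (f n) (g n)]

/-- This serves to neglect additive constants such as `q`, and to make the number of representations
exceed a fixed bound. -/
theorem tendsto_atTop (hf : GrowthRate f α) (hα : 0 < α) : Tendsto f atTop atTop := by
  have h1 : Tendsto (fun n : ℕ => (n : ℝ) * (Real.logb 2 (f n) / n)) atTop atTop :=
    tendsto_natCast_atTop_atTop.atTop_mul_pos hα hf.2
  have h2 : Tendsto (fun n : ℕ => Real.logb 2 (f n)) atTop atTop := by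
    refine h1.congr' ?_
    filter_upwards [eventually_gt_atTop 0] with n hn
    field_simp
  refine tendsto_atTop_mono' _ ?_ h2
  filter_upwards [hf.1] with n hn
  -- The aim is `logb 2 y ≤ y`: from `log (y / 2) ≤ y / 2 - 1` and `log 2 < 1` follows `log y ≤ y /
  -- 2`, and `1 / 2 < log 2`.
  have h3 := Real.add_one_le_exp (Real.logb 2 (f n) * Real.log 2)
  rw [Real.logb, div_mul_cancel₀ _ (Real.log_pos one_lt_two).ne', Real.exp_log hn] at h3
  have h4 : Real.log (f n) ≤ f n / 2 := by
    have := Real.log_le_sub_one_of_pos (half_pos hn)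
    rw [Real.log_div hn.ne' two_ne_zero] at this
    linarith [Real.log_two_lt_d9]
  rw [Real.logb, div_le_iff₀ (Real.log_pos one_lt_two)]
  nlinarith [Real.log_two_gt_d9]

end GrowthRate

/-! ### Powers and binomial coefficients: Stirling's formula and entropy -/

theorem growthRate_pow {z : ℕ} (hz : 0 < z) {w : ℕ → ℕ} {V : ℝ}
    (hw : Tendsto (fun n => (w n : ℝ) / n) atTop (𝓝 V)) :
    GrowthRate (fun n => (z : ℝ) ^ w n) (Real.logb 2 z * V) := by
  refine ⟨Eventually.of_forall fun _ => by positivity, ?_⟩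
  refine (hw.const_mul (Real.logb 2 z)).congr fun n => ?_
  rw [Real.logb_pow]
  ring

/-- The error term `log k! - (k log k - k)` of Stirling's formula. -/
noncomputable def stirlingError (k : ℕ) : ℝ :=
  Real.log (k.factorial : ℝ) - (k * Real.log k - k)

/-- The induction step amounts to `k * log ((k + 1) / k) ≤ 1`. -/
theorem stirlingError_nonneg (k : ℕ) : 0 ≤ stirlingError k := by
  induction k with
  | zero => simp [stirlingError]
  | succ k ih =>
    rcases Nat.eq_zero_or_pos k with rfl | hk
    · simp [stirlingError]
    have hk' : (0 : ℝ) < k := by exact_mod_cast hk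
    have h := Real.log_le_sub_one_of_pos (x := (k + 1) / k) (by positivity)
    rw [Real.log_div (by positivity) hk'.ne'] at h
    have h2 := mul_le_mul_of_nonneg_left h hk'.le
    have h3 : (k : ℝ) * ((k + 1) / k - 1) = 1 := by field_simp; ring
    rw [h3] at h2
    unfold stirlingError at *
    rw [Nat.factorial_succ]
    push_cast
    rw [Real.log_mul (by positivity) (by positivity)]
    linarith

/-- The induction step amounts to `(k + 1) * log (k / (k + 1)) ≤ -1`. A logarithmic error is all
that is needed, so the constant of Stirling's formula plays no role. -/
theorem stirlingError_le (k : ℕ) : stirlingError k ≤ 1 + Real.log k := by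
  induction k with
  | zero => simp [stirlingError]
  | succ k ih =>
    rcases Nat.eq_zero_or_pos k with rfl | hk
    · simp [stirlingError]
    have hk' : (0 : ℝ) < k := by exact_mod_cast hk
    have h := Real.log_le_sub_one_of_pos (x := k / (k + 1)) (by positivity)
    rw [Real.log_div hk'.ne' (by positivity)] at h
    have h2 := mul_le_mul_of_nonneg_left h (by positivity : (0 : ℝ) ≤ k + 1)
    have h3 : ((k : ℝ) + 1) * (k / (k + 1) - 1) = -1 := by field_simp; ring
    rw [h3] at h2
    unfold stirlingError at *
    rw [Nat.factorial_succ]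
    push_cast
    rw [Real.log_mul (by positivity) (by positivity)]
    linarith

/-- The sequence `a` need not tend to infinity: the bound `1 + log a ≤ 1 + 2 * √a` holds for all
values, and `√a / n = √(a / n * (1 / n))` tends to zero. -/
theorem tendsto_stirlingError_div {a : ℕ → ℕ} {α : ℝ}
    (ha : Tendsto (fun n => (a n : ℝ) / n) atTop (𝓝 α)) :
    Tendsto (fun n => stirlingError (a n) / n) atTop (𝓝 0) := by
  have h1 : Tendsto (fun n : ℕ => (1 : ℝ) / n) atTop (𝓝 0) :=
    tendsto_one_div_atTop_nhds_zero_nat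
  have h2 : Tendsto (fun n : ℕ => (1 : ℝ) / n + 2 * √((a n : ℝ) / n * (1 / n))) atTop (𝓝 0) := by
    simpa using h1.add (((ha.mul h1).sqrt).const_mul 2)
  refine squeeze_zero (fun n => by have := stirlingError_nonneg (a n); positivity)
    (fun n => ?_) h2
  rcases Nat.eq_zero_or_pos n with rfl | hn
  · simp
  have hn' : (0 : ℝ) < n := by exact_mod_cast hn
  have h3 : √((a n : ℝ) / n * (1 / n)) = √(a n) / n := by
    rw [show (a n : ℝ) / n * (1 / n) = a n / (n * n) by field_simp,
      Real.sqrt_div (Nat.cast_nonneg _), Real.sqrt_mul_self hn'.le]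
  rw [h3, show (1 : ℝ) / n + 2 * (√(a n) / n) = (1 + 2 * √(a n)) / n by ring]
  gcongr
  refine (stirlingError_le _).trans ?_
  rcases Nat.eq_zero_or_pos (a n) with h0 | h0
  · simp [h0]
  have h4 := Real.log_le_sub_one_of_pos (Real.sqrt_pos.2 (Nat.cast_pos.2 h0 : (0 : ℝ) < a n))
  rw [Real.log_sqrt (Nat.cast_nonneg _)] at h4
  linarith

/-- The right-hand side is continuous also where `α = 0`, so limits can be taken without separating
the degenerate rates. -/
theorem mul_binEntropy_div (α β : ℝ) (hα : α = 0 → β = 0) :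
    α * Real.binEntropy (β / α) =
      Real.negMulLog β + Real.negMulLog (α - β) - Real.negMulLog α := by
  rcases eq_or_ne α 0 with rfl | h
  · simp [hα rfl]
  have key : ∀ x : ℝ, α * Real.negMulLog (x / α) = Real.negMulLog x + x * Real.log α := by
    intro x
    rcases eq_or_ne x 0 with rfl | hx
    · simp
    rw [Real.negMulLog, Real.negMulLog, Real.log_div hx h]
    field_simp
    ring
  rw [Real.binEntropy_eq_negMulLog_add_negMulLog_one_sub, mul_add, key,
    show 1 - β / α = (α - β) / α by field_simp, key]
  simp only [Real.negMulLog]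
  ring

/-- In the logarithm of `a! / (b! (a - b)!)` the linear terms of Stirling's formula and the `log n`
terms from rescaling cancel, because `a = b + (a - b)`; what remains is the `negMulLog` form of the
entropy and three error terms. -/
theorem growthRate_choose {a b : ℕ → ℕ} {α β : ℝ} (hab : ∀ n, b n ≤ a n)
    (ha : Tendsto (fun n => (a n : ℝ) / n) atTop (𝓝 α))
    (hb : Tendsto (fun n => (b n : ℝ) / n) atTop (𝓝 β)) :
    GrowthRate (fun n => ((a n).choose (b n) : ℝ)) (α * h (β / α)) := by
  have hβ0 : 0 ≤ β := ge_of_tendsto' hb fun n => by positivity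
  have hβα : β ≤ α := le_of_tendsto_of_tendsto' hb ha fun n => by
    have := hab n
    gcongr
  have hc : Tendsto (fun n => ((a n - b n : ℕ) : ℝ) / n) atTop (𝓝 (α - β)) := by
    refine (ha.sub hb).congr fun n => ?_
    rw [Nat.cast_sub (hab n), sub_div]
  refine ⟨Eventually.of_forall fun n => Nat.cast_pos.2 (Nat.choose_pos (hab n)), ?_⟩
  have hlim : Tendsto (fun n => (Real.negMulLog ((b n : ℝ) / n)
      + Real.negMulLog (((a n - b n : ℕ) : ℝ) / n) - Real.negMulLog ((a n : ℝ) / n)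
      + (stirlingError (a n) / n - stirlingError (b n) / n - stirlingError (a n - b n) / n))
        / Real.log 2) atTop (𝓝 (α * h (β / α))) := by
    have hcont := Real.continuous_negMulLog
    have h1 := (((hcont.tendsto β).comp hb).add ((hcont.tendsto (α - β)).comp hc)).sub
      ((hcont.tendsto α).comp ha)
    have h2 := ((tendsto_stirlingError_div ha).sub (tendsto_stirlingError_div hb)).sub
      (tendsto_stirlingError_div hc)
    have h3 := (h1.add h2).div_const (Real.log 2)
    have h4 : α * h (β / α) = (Real.negMulLog β + Real.negMulLog (α - β) - Real.negMulLog α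
        + (0 - 0 - 0)) / Real.log 2 := by
      rw [h, ← mul_div_assoc, mul_binEntropy_div α β (fun h0 => by linarith)]
      ring
    rw [h4]
    exact h3
  refine hlim.congr' ?_
  filter_upwards [eventually_gt_atTop 0] with n hn
  have hn' : (0 : ℝ) < n := by exact_mod_cast hn
  have key : ∀ k : ℕ, Real.negMulLog ((k : ℝ) / n) =
      (-(k * Real.log k) + k * Real.log n) / n := by
    intro k
    rcases Nat.eq_zero_or_pos k with rfl | hk
    · simp
    rw [Real.negMulLog, Real.log_div (by positivity) hn'.ne']
    field_simp
    ring
  have hch : Real.log ((a n).choose (b n) : ℝ) = Real.log ((a n).factorial : ℝ)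
      - Real.log ((b n).factorial : ℝ) - Real.log ((a n - b n).factorial : ℝ) := by
    rw [Nat.cast_choose ℝ (hab n), Real.log_div (by positivity) (by positivity),
      Real.log_mul (by positivity) (by positivity)]
    ring
  rw [Real.logb, hch, key, key, key, stirlingError, stirlingError, stirlingError,
    Nat.cast_sub (hab n)]
  field_simp
  ring


/-! ### Counting vectors with prescribed entries and weights -/

section Count

variable {F ι κ : Type*} [Zero F] [Fintype F] [DecidableEq F] [Fintype ι] [DecidableEq ι]
  [DecidableEq κ]

/-- The vectors that have a zero or an allowed entry at every position, and exactly `w c` non-zero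
entries at the positions of each colour `c`. -/
def coloredVectors (allowed : ι → Finset F) (col : ι → κ) (w : κ → ℕ) [Fintype κ] :
    Finset (ι → F) :=
  Finset.univ.filter fun x => (∀ j, x j = 0 ∨ x j ∈ allowed j) ∧
    ∀ c, (Finset.univ.filter fun j => col j = c ∧ x j ≠ 0).card = w c

/-- The vectors are fibred over their supports: each of the `w`-element supports carries `a ^ w`
vectors, since `0` is not an allowed entry. -/
theorem card_filter_weight (allowed : ι → Finset F) (h0 : ∀ j, 0 ∉ allowed j) (a w : ℕ)
    (ha : ∀ j, (allowed j).card = a) :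
    (Finset.univ.filter fun x : ι → F => (∀ j, x j = 0 ∨ x j ∈ allowed j) ∧
      (Finset.univ.filter fun j => x j ≠ 0).card = w).card = (Fintype.card ι).choose w * a ^ w := by
  rw [Finset.card_eq_sum_card_fiberwise (f := fun x => Finset.univ.filter fun j => x j ≠ 0)
    (t := Finset.powersetCard w Finset.univ)]
  · rw [Finset.sum_congr rfl (g := fun _ => a ^ w), Finset.sum_const, Finset.card_powersetCard,
      Finset.card_univ, smul_eq_mul]
    intro T hT
    rw [Finset.mem_powersetCard] at hT
    have : ((Finset.univ.filter fun x : ι → F => (∀ j, x j = 0 ∨ x j ∈ allowed j) ∧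
        (Finset.univ.filter fun j => x j ≠ 0).card = w).filter
          fun x => (Finset.univ.filter fun j => x j ≠ 0) = T) =
        Fintype.piFinset fun j => if j ∈ T then allowed j else {0} := by
      ext x
      simp only [Finset.mem_filter, Finset.mem_univ, true_and, Fintype.mem_piFinset]
      constructor
      · rintro ⟨⟨h1, -⟩, rfl⟩ j
        by_cases hj : x j = 0
        · simp [hj]
        · simpa [hj] using h1 j
      · intro h
        have hT' : (Finset.univ.filter fun j => x j ≠ 0) = T := by
          ext j
          have := h j
          by_cases hj : j ∈ T
          · simp only [hj, if_true] at this
            simp only [Finset.mem_filter, Finset.mem_univ, true_and, hj, iff_true]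
            exact fun h' => h0 j (h' ▸ this)
          · simpa [hj] using this
        refine ⟨⟨fun j => ?_, hT' ▸ hT.2⟩, hT'⟩
        have := h j
        by_cases hj : j ∈ T
        · simp only [hj, if_true] at this
          exact Or.inr this
        · simp only [hj, if_false, Finset.mem_singleton] at this
          exact Or.inl this
    rw [this, Fintype.card_piFinset]
    simp only [apply_ite Finset.card, ha, Finset.card_singleton]
    rw [Finset.prod_ite_mem, Finset.univ_inter, Finset.prod_const, hT.2]
  · intro x hx
    simp only [Finset.coe_filter, Finset.mem_univ, true_and, Set.mem_ofPred_eq] at hx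
    simp [Finset.mem_powersetCard, hx.2]

/-- The conditions on different colour classes are independent, so restriction to the classes is a
bijection onto a product. This one count covers weights, half weights and representations. -/
theorem card_coloredVectors [Fintype κ] (allowed : ι → Finset F) (h0 : ∀ j, 0 ∉ allowed j)
    (col : ι → κ) (w a : κ → ℕ) (ha : ∀ j, (allowed j).card = a (col j)) :
    (coloredVectors allowed col w).card =
      ∏ c, (Finset.univ.filter fun j => col j = c).card.choose (w c) * a c ^ w c := by
  have h1 : ∀ c, (Finset.univ.filter fun j => col j = c).card.choose (w c) * a c ^ w c =
      (Finset.univ.filter fun x : {j // col j = c} → F =>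
        (∀ j, x j = 0 ∨ x j ∈ allowed j.1) ∧
        (Finset.univ.filter fun j => x j ≠ 0).card = w c).card := by
    intro c
    rw [card_filter_weight (fun j : {j // col j = c} => allowed j.1) (fun j => h0 j.1) (a c),
      Fintype.card_subtype]
    rintro ⟨j, rfl⟩
    exact ha j
  have h2 : ∀ (x : ι → F) (c : κ),
      (Finset.univ.filter fun j : {j // col j = c} => x j ≠ 0).card =
        (Finset.univ.filter fun j => col j = c ∧ x j ≠ 0).card := by
    intro x c
    refine Finset.card_bij (fun j _ => j.1) ?_ ?_ ?_
    · rintro ⟨j, rfl⟩ hj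
      simpa using hj
    · intro j _ k _ h
      exact Subtype.ext h
    · intro j hj
      simp only [Finset.mem_filter, Finset.mem_univ, true_and] at hj
      exact ⟨⟨j, hj.1⟩, by simpa using hj.2, rfl⟩
  rw [Finset.prod_congr rfl fun c _ => h1 c, ← Fintype.card_piFinset]
  refine Finset.card_bij' (fun x _ c j => x j.1) (fun f _ j => f (col j) ⟨j, rfl⟩) ?_ ?_ ?_ ?_
  · intro x hx
    simp only [coloredVectors, Finset.mem_filter, Finset.mem_univ, true_and] at hx
    simp only [Fintype.mem_piFinset, Finset.mem_filter, Finset.mem_univ, true_and]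
    exact fun c => ⟨fun j => hx.1 j.1, (h2 x c).trans (hx.2 c)⟩
  · intro f hf
    simp only [Fintype.mem_piFinset, Finset.mem_filter, Finset.mem_univ, true_and] at hf
    simp only [coloredVectors, Finset.mem_filter, Finset.mem_univ, true_and]
    refine ⟨fun j => (hf (col j)).1 ⟨j, rfl⟩, fun c => ?_⟩
    rw [← h2, ← (hf c).2]
    congr 1
    ext ⟨j, rfl⟩
    simp only [Finset.mem_filter, Finset.mem_univ, true_and]
  · intro x _
    rfl
  · intro f _
    ext c ⟨j, rfl⟩
    rfl

end Count

/-- Each colour is refined by membership in the support of `e`, since a representation of `e`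
behaves differently on and off this support. -/
theorem card_filter_col_eq_add {F κ : Type*} [Zero F] [DecidableEq F] [DecidableEq κ] {m : ℕ} (col : Fin m → κ) (c : κ)
    (e x : Fin m → F) :
    (Finset.univ.filter fun j => col j = c ∧ x j ≠ 0).card =
      (Finset.univ.filter fun j => (col j, decide (e j ≠ 0)) = (c, true) ∧ x j ≠ 0).card +
      (Finset.univ.filter fun j => (col j, decide (e j ≠ 0)) = (c, false) ∧ x j ≠ 0).card := by
  rw [← Finset.card_union_of_disjoint]
  · congr 1
    ext j
    simp only [Finset.mem_filter, Finset.mem_univ, true_and, Finset.mem_union, Prod.mk.injEq,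
      decide_eq_true_eq, decide_eq_false_iff_not]
    tauto
  · rw [Finset.disjoint_left]
    intro j
    simp only [Finset.mem_filter, Finset.mem_univ, true_and, Prod.mk.injEq,
      decide_eq_true_eq, decide_eq_false_iff_not]
    tauto

/-! ### The restricted error set and the number of representations -/

section Restricted

variable {F : Type*} [Field F] [DecidableEq F] {g : F}

theorem zero_notMem_errorSet (hg : g ≠ 0) : (0 : F) ∉ errorSet g := by
  simp only [errorSet, Finset.mem_image, not_exists, not_and]
  exact fun i _ => pow_ne_zero i hg

theorem orderOf_pos_of_ne_zero {F : Type*} [Field F] [Fintype F] {g : F} (hg : g ≠ 0) : 0 < orderOf g := by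
  have : 0 < orderOf (Units.mk0 g hg) := orderOf_pos _
  rwa [← orderOf_units, Units.val_mk0] at this

theorem card_errorSet (hg : g ≠ 0) : (errorSet g).card = orderOf g := by
  rw [errorSet, Finset.card_image_of_injOn, Nat.card_Icc, Nat.add_sub_cancel]
  intro i hi j hj (hij : g ^ i = g ^ j)
  simp only [Finset.coe_Icc, Set.mem_Icc] at hi hj
  wlog hle : i ≤ j generalizing i j
  · exact (this hij.symm hj hi (le_of_not_ge hle)).symm
  have h1 : g ^ (j - i) = 1 := by
    have : g ^ i * g ^ (j - i) = g ^ i * 1 := by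
      rw [← pow_add, Nat.add_sub_cancel' hle, mul_one, hij]
    exact mul_left_cancel₀ (pow_ne_zero i hg) this
  have h2 := Nat.eq_zero_of_dvd_of_lt (orderOf_dvd_of_pow_eq_one h1) (by omega)
  omega

variable [Fintype F]

theorem mem_errorSet_iff (hg : g ≠ 0) {x : F} : x ∈ errorSet g ↔ ∃ i : ℕ, x = g ^ i := by
  constructor
  · simp only [errorSet, Finset.mem_image]
    rintro ⟨i, -, rfl⟩
    exact ⟨i, rfl⟩
  · rintro ⟨i, rfl⟩
    have hz := orderOf_pos_of_ne_zero hg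
    rw [errorSet, Finset.mem_image]
    -- Exponents in the error set run from `1` to the order, so the residue `0` is replaced by the
    -- order itself.
    rcases Nat.eq_zero_or_pos (i % orderOf g) with h | h
    · refine ⟨orderOf g, Finset.mem_Icc.2 ⟨hz, le_rfl⟩, ?_⟩
      rw [← pow_mod_orderOf g i, h, pow_zero, pow_orderOf_eq_one]
    · exact ⟨i % orderOf g, Finset.mem_Icc.2 ⟨h, (Nat.mod_lt _ hz).le⟩, pow_mod_orderOf g i⟩

theorem neg_mem_errorSet (hg : g ≠ 0) (h : -1 ∈ errorSet g) {x : F} (hx : x ∈ errorSet g) :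
    -x ∈ errorSet g := by
  rw [mem_errorSet_iff hg] at *
  obtain ⟨i, hi⟩ := h
  obtain ⟨j, rfl⟩ := hx
  exact ⟨i + j, by rw [pow_add, ← hi, neg_one_mul]⟩

variable {m : ℕ}

theorem wellFormed_eq_coloredVectors (g : F) (m w : ℕ) :
    wellFormed g m w =
      coloredVectors (fun _ : Fin m => errorSet g) (fun _ => ()) (fun _ => w) := by
  ext x
  simp [wellFormed, coloredVectors, hammingNorm]

theorem card_wellFormed (hg : g ≠ 0) (m w : ℕ) :
    (wellFormed g m w).card = m.choose w * orderOf g ^ w := by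
  rw [wellFormed_eq_coloredVectors, card_coloredVectors _ (fun _ => zero_notMem_errorSet hg) _ _
    (fun _ => orderOf g) fun _ => card_errorSet hg]
  simp

/-- The vectors that represent `e` together with their difference to `e`, with `c` positions taken
from the support of `e` and `ε` further positions, for each colour. -/
noncomputable def coloredRepresentations {κ : Type*} [Fintype κ] [DecidableEq κ] (g : F)
    (e : Fin m → F) (col : Fin m → κ) (w : κ → Bool → ℕ) : Finset (Fin m → F) :=
  coloredVectors (fun j => if e j ≠ 0 then {e j} else errorSet g)
    (fun j => (col j, decide (e j ≠ 0))) (fun c => w c.1 c.2)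

theorem card_coloredRepresentations {κ : Type*} [Fintype κ] [DecidableEq κ] (hg : g ≠ 0)
    (e : Fin m → F) (col : Fin m → κ) (w : κ → Bool → ℕ) :
    (coloredRepresentations g e col w).card = ∏ c,
      ((Finset.univ.filter fun j => col j = c ∧ e j ≠ 0).card.choose (w c true) *
      ((Finset.univ.filter fun j => col j = c ∧ e j = 0).card.choose (w c false) *
        orderOf g ^ w c false)) := by
  rw [coloredRepresentations, card_coloredVectors _ _ _ _
    (fun c => if c.2 then 1 else orderOf g)]
  · rw [Fintype.prod_prod_type]
    simp [Prod.ext_iff]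
  · intro j
    by_cases h : e j = 0 <;> simp [h, card_errorSet hg]
  · intro j
    split_ifs with h
    · simpa using Ne.symm h
    · exact zero_notMem_errorSet hg

/-- Both summands of a coloured representation have the expected weights. -/
theorem mem_coloredVectors_of_mem_coloredRepresentations {κ : Type*} [Fintype κ] [DecidableEq κ]
    (hg : g ≠ 0) {e : Fin m → F} {col : Fin m → κ} {w : κ → Bool → ℕ} {w' : κ → ℕ}
    (hcancel : -1 ∈ errorSet g ∨ ∀ c, w c false = 0)
    (he : e ∈ coloredVectors (fun _ => errorSet g) col w')
    (hw : ∀ c, w' c = 2 * w c true) {x : Fin m → F} (hx : x ∈ coloredRepresentations g e col w) :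
    x ∈ coloredVectors (fun _ => errorSet g) col (fun c => w c true + w c false) ∧
    e - x ∈ coloredVectors (fun _ => errorSet g) col (fun c => w c true + w c false) ∧
    ∀ j, x j ≠ 0 → (e - x) j ≠ 0 → x j + (e - x) j = 0 := by
  simp only [coloredRepresentations, coloredVectors, Finset.mem_filter, Finset.mem_univ,
    true_and] at hx he
  obtain ⟨hx1, hx2⟩ := hx
  obtain ⟨he1, he2⟩ := he
  have hcase : ∀ j, (e j ≠ 0 ∧ (x j = 0 ∨ x j = e j)) ∨
      (e j = 0 ∧ (x j = 0 ∨ x j ∈ errorSet g)) := by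
    intro j
    have := hx1 j
    by_cases h : e j = 0
    · right; simpa [h] using this
    · left; simpa [h] using this
  refine ⟨?_, ?_, ?_⟩
  · simp only [coloredVectors, Finset.mem_filter, Finset.mem_univ, true_and]
    refine ⟨fun j => ?_, fun c => ?_⟩
    · rcases hcase j with ⟨h1, h2 | h2⟩ | ⟨h1, h2⟩
      · exact Or.inl h2
      · exact h2 ▸ he1 j
      · exact h2
    · rw [card_filter_col_eq_add col c e x, hx2 (c, true), hx2 (c, false)]
  · simp only [coloredVectors, Finset.mem_filter, Finset.mem_univ, true_and]
    -- Off the support of `e` the second summand is `-x`. This is the place where `-1 ∈ 𝔼` is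
    -- needed, unless there is no overlap at all.
    have hneg : ∀ j, e j = 0 → x j = 0 ∨ -x j ∈ errorSet g := by
      intro j hj
      rcases hcancel with h | h
      · rcases hcase j with ⟨h1, -⟩ | ⟨-, h2 | h2⟩
        · exact absurd hj h1
        · exact Or.inl h2
        · exact Or.inr (neg_mem_errorSet hg h h2)
      · left
        by_contra hne
        have h1 := hx2 (col j, false)
        rw [h, Finset.card_eq_zero] at h1
        exact Finset.notMem_empty j (h1 ▸ by simp [hj, hne])
    refine ⟨fun j => ?_, fun c => ?_⟩
    · rcases hcase j with ⟨h1, h2 | h2⟩ | ⟨h1, h2⟩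
      · simpa [h2] using he1 j
      · simp [h2]
      · simpa [h1] using hneg j h1
    · rw [card_filter_col_eq_add col c e (e - x)]
      have h3 := hx2 (c, true)
      have h4 := hx2 (c, false)
      have h5 := he2 c
      rw [hw] at h5
      have h6 : (Finset.univ.filter fun j =>
          (col j, decide (e j ≠ 0)) = (c, false) ∧ (e - x) j ≠ 0).card = w c false := by
        rw [← h4]
        congr 1
        ext j
        simp only [Finset.mem_filter, Finset.mem_univ, true_and, Prod.mk.injEq,
          decide_eq_false_iff_not, not_not, and_congr_right_iff, Pi.sub_apply]
        rintro ⟨-, h⟩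
        simp [h]
      -- On the support of `e` exactly one of `x` and `e - x` is non-zero, so their weights there
      -- add up to that of `e`.
      have h7 : (Finset.univ.filter fun j => col j = c ∧ e j ≠ 0).card =
          (Finset.univ.filter fun j => (col j, decide (e j ≠ 0)) = (c, true) ∧ x j ≠ 0).card +
          (Finset.univ.filter fun j =>
            (col j, decide (e j ≠ 0)) = (c, true) ∧ (e - x) j ≠ 0).card := by
        rw [← Finset.card_union_of_disjoint]
        · congr 1
          ext j
          simp only [Finset.mem_filter, Finset.mem_univ, true_and, Finset.mem_union,
            Prod.mk.injEq, decide_eq_true_eq, Pi.sub_apply]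
          rcases hcase j with ⟨h1, h2 | h2⟩ | ⟨h1, h2⟩ <;> simp [h1, h2]
        · rw [Finset.disjoint_left]
          intro j
          simp only [Finset.mem_filter, Finset.mem_univ, true_and,
            Prod.mk.injEq, decide_eq_true_eq, Pi.sub_apply]
          rcases hcase j with ⟨h1, h2 | h2⟩ | ⟨h1, h2⟩ <;> simp [h1, h2]
      simp only at h3 h4
      omega
  · intro j h1 h2
    simp only [Pi.sub_apply] at *
    rcases hcase j with ⟨h3, h4 | h4⟩ | ⟨h3, h4⟩
    · exact absurd h4 h1
    · simp [h4] at h2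
    · simp [h3]

theorem mem_wellFormed_of_coloredVectors {κ : Type*} [Fintype κ] [DecidableEq κ]
    {col : Fin m → κ} {w : κ → ℕ} {x : Fin m → F}
    (hx : x ∈ coloredVectors (fun _ => errorSet g) col w) : x ∈ wellFormed g m (∑ c, w c) := by
  simp only [coloredVectors, wellFormed, Finset.mem_filter, Finset.mem_univ, true_and] at *
  refine ⟨hx.1, ?_⟩
  rw [hammingNorm, Finset.card_eq_sum_card_fiberwise (f := col) (t := Finset.univ)
    (by intro j _; simp)]
  refine Finset.sum_congr rfl fun c _ => ?_
  rw [← hx.2 c, Finset.filter_filter]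
  congr 1
  ext j
  simp [and_comm]

/-- Where `e` is non-zero, overlapping summands could not cancel, so `x` is `0` or `e` there. Off
the support, `x` and `e - x` have the same weight; as their total weights also agree, each takes `v
/ 2` positions of the support and `ε` positions outside. -/
theorem representations_eq (hg : g ≠ 0) {v w ε : ℕ} (hw : 2 * w = v + 2 * ε)
    (hcancel : -1 ∈ errorSet g ∨ ε = 0) {e : Fin m → F} (he : e ∈ wellFormed g m v) :
    representations g w e = coloredRepresentations g e (fun _ => ())
      (fun _ b => if b then v / 2 else ε) := by
  ext x
  constructor
  · intro hx
    simp only [representations, wellFormed, Finset.mem_filter, Finset.mem_univ, true_and] at hx he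
    obtain ⟨⟨hx1, hx2⟩, ⟨hx3, hx4⟩, hx5⟩ := hx
    obtain ⟨he1, he2⟩ := he
    have hcase : ∀ j, e j ≠ 0 → x j = 0 ∨ x j = e j := by
      intro j hj
      by_contra! h
      have := hx5 j h.1 (by simpa [sub_eq_zero] using h.2.symm)
      simp only [Pi.sub_apply, add_sub_cancel] at this
      exact hj this
    have hn : ∀ y : Fin m → F, hammingNorm y =
        (Finset.univ.filter fun j => ((), decide (e j ≠ 0)) = ((), true) ∧ y j ≠ 0).card +
        (Finset.univ.filter fun j => ((), decide (e j ≠ 0)) = ((), false) ∧ y j ≠ 0).card := by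
      intro y
      rw [← card_filter_col_eq_add (fun _ => ()) () e y, hammingNorm]
      simp
    have h6 : (Finset.univ.filter fun j =>
        ((), decide (e j ≠ 0)) = ((), false) ∧ (e - x) j ≠ 0).card =
        (Finset.univ.filter fun j =>
          ((), decide (e j ≠ 0)) = ((), false) ∧ x j ≠ 0).card := by
      congr 1
      ext j
      simp only [Finset.mem_filter, Finset.mem_univ, true_and, Prod.mk.injEq,
        decide_eq_false_iff_not, not_not, and_congr_right_iff, Pi.sub_apply]
      intro h
      simp [h]
    have h7 : hammingNorm e =
        (Finset.univ.filter fun j => ((), decide (e j ≠ 0)) = ((), true) ∧ x j ≠ 0).card +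
        (Finset.univ.filter fun j =>
          ((), decide (e j ≠ 0)) = ((), true) ∧ (e - x) j ≠ 0).card := by
      rw [← Finset.card_union_of_disjoint, hammingNorm]
      · congr 1
        ext j
        simp only [Finset.mem_filter, Finset.mem_univ, true_and, Finset.mem_union,
          Prod.mk.injEq, decide_eq_true_eq, Pi.sub_apply]
        by_cases h : e j = 0
        · simp [h]
        · rcases hcase j h with h2 | h2 <;> simp [h, h2]
      · rw [Finset.disjoint_left]
        intro j
        simp only [Finset.mem_filter, Finset.mem_univ, true_and,
          Prod.mk.injEq, decide_eq_true_eq, Pi.sub_apply]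
        by_cases h : e j = 0
        · simp [h]
        · rcases hcase j h with h2 | h2 <;> simp [h2]
    have h8 := hn x
    have h9 := hn (e - x)
    simp only [coloredRepresentations, coloredVectors, Finset.mem_filter, Finset.mem_univ,
      true_and]
    refine ⟨fun j => ?_, ?_⟩
    · by_cases h : e j = 0
      · simpa [h] using hx1 j
      · simpa [h] using hcase j h
    · rintro ⟨⟨⟩, b⟩
      change (Finset.univ.filter fun j => ((), decide (e j ≠ 0)) = ((), b) ∧ x j ≠ 0).card = _
      cases b
      · simp only [Bool.false_eq_true, if_false]
        omega
      · simp only [if_true]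
        omega
  · intro hx
    rw [wellFormed_eq_coloredVectors] at he
    obtain ⟨h1, h2, h3⟩ := mem_coloredVectors_of_mem_coloredRepresentations hg
      (hcancel.imp id fun h _ => by simp [h]) he
      (fun _ => by simp only [if_true]; omega) hx
    rw [representations, Finset.mem_filter]
    have h4 := mem_wellFormed_of_coloredVectors h1
    have h5 := mem_wellFormed_of_coloredVectors h2
    simp only [Finset.univ_unique, Finset.sum_const, Finset.card_singleton, one_smul, if_true,
      Bool.false_eq_true, if_false, show v / 2 + ε = w by omega] at h4 h5
    exact ⟨h4, h5, h3⟩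

/-- The factors choose the half of the support that goes to the first summand, the overlapping
positions, and the entries there. -/
theorem numRepresentations_eq (hg : g ≠ 0) {v w ε : ℕ} (hw : 2 * w = v + 2 * ε)
    (hroom : v ≤ m) (hcancel : -1 ∈ errorSet g ∨ ε = 0) :
    numRepresentations g m v w =
      v.choose (v / 2) * ((m - v).choose ε * orderOf g ^ ε) := by
  have hcard : ∀ e ∈ wellFormed g m v, (representations g w e).card =
      v.choose (v / 2) * ((m - v).choose ε * orderOf g ^ ε) := by
    intro e he
    rw [representations_eq hg hw hcancel he, card_coloredRepresentations hg]
    simp only [wellFormed, Finset.mem_filter, hammingNorm, ne_eq] at he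
    have h1 := he.2.2
    have h2 : (Finset.univ.filter fun j => e j = 0).card = m - v := by
      have := Finset.card_filter_add_card_filter_not (s := (Finset.univ : Finset (Fin m)))
        (fun j => e j = 0)
      rw [Finset.card_univ, Fintype.card_fin] at this
      omega
    simp [h1, h2]
  have hne : (wellFormed g m v).Nonempty := by
    rw [← Finset.card_pos, card_wellFormed hg]
    have := orderOf_pos_of_ne_zero hg
    have := Nat.choose_pos hroom
    positivity
  rw [numRepresentations, Finset.sup_congr rfl hcard, Finset.sup_const hne]

/-! ### Vectors that are split into two halves -/

/-- Whether a position belongs to the first half. -/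
def inLeft (m : ℕ) (j : Fin m) : Bool := decide (2 * j.val < m)

theorem card_inLeft {M : ℕ} (hM : m = 2 * M) (b : Bool) :
    (Finset.univ.filter fun j => inLeft m j = b).card = M := by
  have h1 : (Finset.univ.filter fun j => inLeft m j = true).card = M := by
    have : (Finset.univ.filter fun j : Fin m => inLeft m j = true) =
        (Finset.univ.filter fun j : Fin m => j.val < M) := by
      ext j
      simp only [inLeft, decide_eq_true_eq, Finset.mem_filter, Finset.mem_univ, true_and]
      omega
    rw [this, Fin.card_filter_val_lt]
    omega
  cases b
  · have := Finset.card_filter_add_card_filter_not (s := (Finset.univ : Finset (Fin m)))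
      (fun j => inLeft m j = true)
    rw [Finset.card_univ, Fintype.card_fin] at this
    simp only [Bool.not_eq_true] at this
    omega
  · exact h1

/-- The vectors with entries in `𝔼₀` that have `a` non-zero entries in the first half and `b`
non-zero entries in the second half. -/
noncomputable def splitVectors (g : F) (m a b : ℕ) : Finset (Fin m → F) :=
  coloredVectors (fun _ => errorSet g) (inLeft m) (fun c => if c then a else b)

theorem splitVectors_subset (g : F) (m a b : ℕ) :
    splitVectors g m a b ⊆ wellFormed g m (a + b) := by
  intro x hx
  simpa using mem_wellFormed_of_coloredVectors hx

theorem card_splitVectors (hg : g ≠ 0) {M : ℕ} (hM : m = 2 * M) (a b : ℕ) :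
    (splitVectors g m a b).card =
      M.choose a * orderOf g ^ a * (M.choose b * orderOf g ^ b) := by
  rw [splitVectors, card_coloredVectors _ (fun _ => zero_notMem_errorSet hg) _ _
    (fun _ => orderOf g) fun _ => card_errorSet hg]
  simp [card_inLeft hM]

theorem leftBase_eq (g : F) (m w : ℕ) :
    (leftBase g m w).val = (splitVectors g m w 0).toList := by
  change Finset.toList _ = Finset.toList _
  congr 1
  ext x
  simp only [wellFormed, splitVectors, coloredVectors, Finset.mem_filter, Finset.mem_univ,
    true_and, Bool.forall_bool, Finset.card_eq_zero, Finset.filter_eq_empty_iff, inLeft,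
    decide_eq_true_eq, decide_eq_false_iff_not, if_true, Bool.false_eq_true, if_false,
    hammingNorm]
  constructor
  · rintro ⟨⟨h1, rfl⟩, h2⟩
    refine ⟨h1, fun j _ hj => hj.1 (h2 j hj.2), ?_⟩
    congr 1
    ext j
    simp only [Finset.mem_filter, Finset.mem_univ, true_and]
    exact ⟨fun h => h.2, fun h => ⟨h2 j h, h⟩⟩
  · rintro ⟨h1, h2, rfl⟩
    have h3 : ∀ j, x j ≠ 0 → 2 * j.val < m := fun j hj => by
      by_contra h
      exact h2 trivial ⟨h, hj⟩
    refine ⟨⟨h1, ?_⟩, h3⟩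
    congr 1
    ext j
    simp only [Finset.mem_filter, Finset.mem_univ, true_and]
    exact ⟨fun h => ⟨h3 j h, h⟩, fun h => h.2⟩

theorem rightBase_eq (g : F) (m w : ℕ) :
    (rightBase g m w).val = (splitVectors g m 0 w).toList := by
  change Finset.toList _ = Finset.toList _
  congr 1
  ext x
  simp only [wellFormed, splitVectors, coloredVectors, Finset.mem_filter, Finset.mem_univ,
    true_and, Bool.forall_bool, Finset.card_eq_zero, Finset.filter_eq_empty_iff, inLeft,
    decide_eq_true_eq, decide_eq_false_iff_not, if_true, Bool.false_eq_true, if_false,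
    hammingNorm, not_lt]
  constructor
  · rintro ⟨⟨h1, rfl⟩, h2⟩
    refine ⟨h1, ?_, fun j _ hj => absurd (h2 j hj.2) (not_le.2 hj.1)⟩
    congr 1
    ext j
    simp only [Finset.mem_filter, Finset.mem_univ, true_and]
    exact ⟨fun h => h.2, fun h => ⟨h2 j h, h⟩⟩
  · rintro ⟨h1, rfl, h2⟩
    have h3 : ∀ j, x j ≠ 0 → m ≤ 2 * j.val := fun j hj => by
      by_contra h
      exact h2 trivial ⟨not_le.1 h, hj⟩
    refine ⟨⟨h1, ?_⟩, h3⟩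
    congr 1
    ext j
    simp only [Finset.mem_filter, Finset.mem_univ, true_and]
    exact ⟨fun h => ⟨h3 j h, h⟩, fun h => h.2⟩

/-- A vector splits uniquely into its two halves. -/
theorem exists_add_eq_of_mem_splitVectors {a b : ℕ} {x : Fin m → F}
    (hx : x ∈ splitVectors g m a b) :
    ∃ x₁ ∈ splitVectors g m a 0, ∃ x₂ ∈ splitVectors g m 0 b, x₁ + x₂ = x := by
  simp only [splitVectors, coloredVectors, Finset.mem_filter, Finset.mem_univ,
    true_and, Bool.forall_bool, if_true, Bool.false_eq_true, if_false] at hx ⊢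
  obtain ⟨h1, h2, h3⟩ := hx
  refine ⟨fun j => if inLeft m j = true then x j else 0, ⟨?_, ?_, ?_⟩,
    fun j => if inLeft m j = true then 0 else x j, ⟨?_, ?_, ?_⟩, ?_⟩
  · intro j
    dsimp only
    split_ifs
    · exact h1 j
    · simp
  · rw [Finset.card_eq_zero, Finset.filter_eq_empty_iff]
    rintro j - ⟨h4, h5⟩
    simp [h4] at h5
  · rw [← h3]
    congr 1
    ext j
    simp +contextual
  · intro j
    dsimp only
    split_ifs
    · simp
    · exact h1 j
  · rw [← h2]
    congr 1
    ext j
    simp +contextual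
  · rw [Finset.card_eq_zero, Finset.filter_eq_empty_iff]
    rintro j - ⟨h4, h5⟩
    simp [h4] at h5
  · ext j
    simp only [Pi.add_apply]
    split_ifs <;> simp

/-- Representations of a vector of half weights `a` and `b` by two vectors with the same weight in
both halves. -/
noncomputable def splitRepresentations (g : F) (e : Fin m → F) (a b ε₁ ε₂ : ℕ) :
    Finset (Fin m → F) :=
  coloredRepresentations g e (inLeft m)
    (fun c d => if c then (if d then a / 2 else ε₁) else (if d then b / 2 else ε₂))

/-- The number of split representations. -/
def numSplitRepresentations (z M a b ε₁ ε₂ : ℕ) : ℕ :=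
  a.choose (a / 2) * ((M - a).choose ε₁ * z ^ ε₁) *
    (b.choose (b / 2) * ((M - b).choose ε₂ * z ^ ε₂))

theorem card_splitRepresentations (hg : g ≠ 0) {M : ℕ} (hM : m = 2 * M) {a b : ℕ} (ε₁ ε₂ : ℕ)
    {e : Fin m → F} (he : e ∈ splitVectors g m a b) :
    (splitRepresentations g e a b ε₁ ε₂).card =
      numSplitRepresentations (orderOf g) M a b ε₁ ε₂ := by
  simp only [splitVectors, coloredVectors, Finset.mem_filter, Finset.mem_univ, true_and] at he
  have h1 := he.2 true
  have h2 := he.2 false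
  have h3 : ∀ c, (Finset.univ.filter fun j => inLeft m j = c ∧ e j = 0).card +
      (Finset.univ.filter fun j => inLeft m j = c ∧ e j ≠ 0).card = M := by
    intro c
    rw [← card_inLeft hM c, ← Finset.filter_filter, ← Finset.filter_filter,
      Finset.card_filter_add_card_filter_not]
  have h4 := h3 true
  have h5 := h3 false
  simp only [if_true, Bool.false_eq_true, if_false] at h1 h2
  rw [splitRepresentations, card_coloredRepresentations hg, Fintype.prod_bool, h1, h2,
    numSplitRepresentations, show (Finset.univ.filter fun j => inLeft m j = true ∧ e j = 0).card =
      M - a by omega, show (Finset.univ.filter fun j => inLeft m j = false ∧ e j = 0).card =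
      M - b by omega]
  simp

/-- The half weights `a` and `b` of `e` may differ; the overlaps `ε₁` and `ε₂` compensate, so that
both summands have weight `w` in each half and can be built from the base lists. -/
theorem mem_splitVectors_of_mem_splitRepresentations (hg : g ≠ 0) {a b ε₁ ε₂ w : ℕ}
    (hcancel : -1 ∈ errorSet g ∨ (ε₁ = 0 ∧ ε₂ = 0)) (ha : 2 * w = a + 2 * ε₁)
    (hb : 2 * w = b + 2 * ε₂) {e x : Fin m → F} (he : e ∈ splitVectors g m a b)
    (hx : x ∈ splitRepresentations g e a b ε₁ ε₂) :
    x ∈ splitVectors g m w w ∧ e - x ∈ splitVectors g m w w := by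
  have h := mem_coloredVectors_of_mem_coloredRepresentations hg
    (hcancel.imp id fun h c => by cases c <;> simp [h.1, h.2]) he
    (fun c => by cases c <;> simp <;> omega) hx
  have h2 : (fun c : Bool => (if c = true then w else w)) = fun c : Bool =>
      (fun c d => if c = true then (if d = true then a / 2 else ε₁)
        else (if d = true then b / 2 else ε₂) : Bool → Bool → ℕ) c true +
      (fun c d => if c = true then (if d = true then a / 2 else ε₁)
        else (if d = true then b / 2 else ε₂) : Bool → Bool → ℕ) c false := by
    ext c
    cases c <;> simp <;> omega
  rw [splitVectors, h2]
  exact ⟨h.1, h.2.1⟩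

end Restricted


/-! ### The steps and the results of the algorithm -/

section HashTable

variable {α κ : Type*} [DecidableEq κ]

theorem buildTable_val (key : α → κ) (l : List α) (c : κ) :
    (buildTable key l).val c = l.filter fun x => key x = c := by
  induction l with
  | nil => rfl
  | cons x xs ih =>
    simp only [buildTable, List.filter_cons, decide_eq_true_eq]
    by_cases hx : key x = c
    · subst hx
      simp [ih]
    · simp [hx, Function.update_of_ne (Ne.symm hx), ih]

theorem buildTable_steps (key : α → κ) (l : List α) : (buildTable key l).steps = l.length := by
  induction l with
  | nil => rfl
  | cons x xs ih => simp [buildTable, ih]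

variable [Add α] [DecidableEq α] (good : Finset α)

theorem processBucket_steps (y : α) (l : List α) (acc : Timed (List α)) :
    (processBucket good y l acc).steps = acc.steps + l.length := by
  induction l generalizing acc with
  | nil => rfl
  | cons x xs ih =>
    rw [processBucket, ih, List.length_cons]
    dsimp only
    omega

theorem mem_processBucket (y : α) (l : List α) (acc : Timed (List α)) (s : α) :
    s ∈ (processBucket good y l acc).val ↔
      s ∈ acc.val ∨ ∃ x ∈ l, s = x + y ∧ s ∈ good := by
  induction l generalizing acc with
  | nil => simp [processBucket]
  | cons x xs ih =>
    rw [processBucket, ih]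
    by_cases hx : x + y ∈ good
    · simp only [hx, if_true, List.mem_insert_iff, List.mem_cons, exists_eq_or_imp]
      constructor
      · rintro ((rfl | h) | h)
        · exact Or.inr (Or.inl ⟨rfl, hx⟩)
        · exact Or.inl h
        · exact Or.inr (Or.inr h)
      · rintro (h | ⟨rfl, -⟩ | h)
        · exact Or.inl (Or.inr h)
        · exact Or.inl (Or.inl rfl)
        · exact Or.inr h
    · simp only [hx, if_false, List.mem_cons, exists_eq_or_imp]
      constructor
      · rintro (h | h)
        · exact Or.inl h
        · exact Or.inr (Or.inr h)
      · rintro (h | ⟨rfl, h⟩ | h)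
        · exact Or.inl h
        · exact absurd h hx
        · exact Or.inr h

theorem nodup_processBucket (y : α) (l : List α) (acc : Timed (List α)) (h : acc.val.Nodup) :
    (processBucket good y l acc).val.Nodup := by
  induction l generalizing acc with
  | nil => exact h
  | cons x xs ih =>
    rw [processBucket]
    refine ih _ ?_
    dsimp only
    split_ifs
    · exact h.insert
    · exact h

theorem probe_steps (key : α → κ) (T : κ → List α) (l : List α) (acc : Timed (List α)) :
    (probe good key T l acc).steps =
      acc.steps + l.length + (l.map fun y => (T (key y)).length).sum := by
  induction l generalizing acc with
  | nil => rfl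
  | cons y ys ih =>
    rw [probe, ih, processBucket_steps, List.length_cons, List.map_cons, List.sum_cons]
    dsimp only
    omega

theorem mem_probe (key : α → κ) (T : κ → List α) (l : List α) (acc : Timed (List α)) (s : α) :
    s ∈ (probe good key T l acc).val ↔
      s ∈ acc.val ∨ ∃ y ∈ l, ∃ x ∈ T (key y), s = x + y ∧ s ∈ good := by
  induction l generalizing acc with
  | nil => simp [probe]
  | cons y ys ih =>
    rw [probe, ih, mem_processBucket]
    simp only [List.mem_cons, exists_eq_or_imp, or_assoc]

theorem nodup_probe (key : α → κ) (T : κ → List α) (l : List α) (acc : Timed (List α))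
    (h : acc.val.Nodup) : (probe good key T l acc).val.Nodup := by
  induction l generalizing acc with
  | nil => exact h
  | cons y ys ih => exact ih _ (nodup_processBucket good _ _ _ h)

end HashTable

section Merge

variable {F : Type*} [Field F] [DecidableEq F] {m ℓ : ℕ}

/-- The product `x A` agrees with `t` on the first `u` positions. -/
def Agrees (A : Matrix (Fin m) (Fin ℓ) F) (u : ℕ) (t : Fin ℓ → F) (x : Fin m → F) : Prop :=
  ∀ j : Fin ℓ, j.val < u → Matrix.vecMul x A j = t j

instance (A : Matrix (Fin m) (Fin ℓ) F) (u : ℕ) (t : Fin ℓ → F) (x : Fin m → F) :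
    Decidable (Agrees A u t x) := by
  unfold Agrees
  infer_instance

/-- The pairs that collide when two sets of vectors are merged. -/
def collisions (A : Matrix (Fin m) (Fin ℓ) F) (u : ℕ) (t : Fin ℓ → F)
    (S T : Finset (Fin m → F)) : Finset ((Fin m → F) × (Fin m → F)) :=
  (S ×ˢ T).filter fun p => Agrees A u t (p.1 + p.2)

variable [Fintype F]

/-- The set of the sums that result from a merge. -/
noncomputable def mergeSet (g : F) (A : Matrix (Fin m) (Fin ℓ) F) (u : ℕ) (t : Fin ℓ → F) (w : ℕ)
    (S T : Finset (Fin m → F)) : Finset (Fin m → F) :=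
  ((collisions A u t S T).image fun p => p.1 + p.2) ∩ wellFormed g m w

/-- The stored key is the image of `x` and the searched key is the target minus the image of `y`;
positions from `u` on are set to `0` in both and never distinguish anything. -/
theorem key_eq_iff (A : Matrix (Fin m) (Fin ℓ) F) (u : ℕ) (t : Fin ℓ → F) (x y : Fin m → F) :
    (fun j : Fin ℓ => if j.val < u then Matrix.vecMul x A j else 0) =
      (fun j : Fin ℓ => if j.val < u then t j - Matrix.vecMul y A j else 0) ↔
    Agrees A u t (x + y) := by
  rw [funext_iff, Agrees]
  refine forall_congr' fun j => ?_
  rw [Matrix.add_vecMul, Pi.add_apply]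
  by_cases h : j.val < u
  · simp [h, eq_sub_iff_add_eq]
  · simp [h]

theorem merge_val (g : F) (A : Matrix (Fin m) (Fin ℓ) F) (u : ℕ) (t : Fin ℓ → F) (w : ℕ)
    (l₁ l₂ : List (Fin m → F)) :
    (merge g A u t w l₁ l₂).val.toFinset = mergeSet g A u t w l₁.toFinset l₂.toFinset := by
  ext s
  simp only [List.mem_toFinset, merge, mem_probe, buildTable_val, mergeSet, collisions,
    List.not_mem_nil, false_or, List.mem_filter, decide_eq_true_eq, key_eq_iff,
    Finset.mem_inter, Finset.mem_image, Finset.mem_filter, Finset.mem_product, Prod.exists]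
  constructor
  · rintro ⟨y, hy, x, ⟨hx, h⟩, rfl, hs⟩
    exact ⟨⟨x, y, ⟨⟨hx, hy⟩, h⟩, rfl⟩, hs⟩
  · rintro ⟨⟨x, y, ⟨⟨hx, hy⟩, h⟩, rfl⟩, hs⟩
    exact ⟨y, hy, x, ⟨hx, h⟩, rfl, hs⟩

theorem nodup_merge (g : F) (A : Matrix (Fin m) (Fin ℓ) F) (u : ℕ) (t : Fin ℓ → F) (w : ℕ)
    (l₁ l₂ : List (Fin m → F)) : (merge g A u t w l₁ l₂).val.Nodup :=
  nodup_probe _ _ _ _ _ List.nodup_nil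

/-- Each first vector is inserted once, each second vector looked up once, and the buckets found
contain exactly the colliding pairs. Absence of repetitions turns list lengths into cardinalities.
-/
theorem merge_steps (g : F) (A : Matrix (Fin m) (Fin ℓ) F) (u : ℕ) (t : Fin ℓ → F) (w : ℕ)
    {l₁ l₂ : List (Fin m → F)} (h₁ : l₁.Nodup) (h₂ : l₂.Nodup) :
    (merge g A u t w l₁ l₂).steps = l₁.toFinset.card + l₂.toFinset.card +
      (collisions A u t l₁.toFinset l₂.toFinset).card := by
  rw [merge, probe_steps, buildTable_steps, List.toFinset_card_of_nodup h₁,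
    List.toFinset_card_of_nodup h₂]
  congr 1
  rw [← List.sum_toFinset _ h₂, collisions, Finset.card_filter, Finset.sum_product_right]
  refine Finset.sum_congr rfl fun y _ => ?_
  rw [buildTable_val, ← Finset.card_filter, ← List.toFinset_card_of_nodup (h₁.filter _),
    List.toFinset_filter]
  simp only [decide_eq_true_eq, key_eq_iff]

end Merge

/-! ### The lists of a run and its exact number of steps -/

section Run

variable {F : Type*} [Field F] [Fintype F] [DecidableEq F] (g : F) (p : Params)
  (A : Matrix (Fin (p.k + p.ℓ)) (Fin p.ℓ) F) (t s : Fin p.ℓ → F)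

/-- The set of vectors in a base list. -/
noncomputable abbrev Params.leftSet : Finset (Fin (p.k + p.ℓ) → F) :=
  splitVectors g (p.k + p.ℓ) (p.v₂ / 2) 0

/-- The set of vectors in the other base list. -/
noncomputable abbrev Params.rightSet : Finset (Fin (p.k + p.ℓ) → F) :=
  splitVectors g (p.k + p.ℓ) 0 (p.v₂ / 2)

/-- The set of vectors in the level-2 list with target `t`. -/
noncomputable def Params.listC : Finset (Fin (p.k + p.ℓ) → F) :=
  mergeSet g A (p.u₁ g) t p.v₂ (p.leftSet g) (p.rightSet g)

/-- The set of vectors in the level-1 list with target `t`. -/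
noncomputable def Params.listD : Finset (Fin (p.k + p.ℓ) → F) :=
  mergeSet g A (p.u₀ g) t p.v₁ (p.listC g A 0) (p.listC g A t)

/-- The colliding pairs of base vectors. -/
noncomputable def Params.baseCollisions :
    Finset ((Fin (p.k + p.ℓ) → F) × (Fin (p.k + p.ℓ) → F)) :=
  collisions A (p.u₁ g) t (p.leftSet g) (p.rightSet g)

/-- The colliding pairs of level-2 vectors. -/
noncomputable def Params.middleCollisions :
    Finset ((Fin (p.k + p.ℓ) → F) × (Fin (p.k + p.ℓ) → F)) :=
  collisions A (p.u₀ g) t (p.listC g A 0) (p.listC g A t)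

/-- The colliding pairs of level-1 vectors. -/
noncomputable def Params.finalCollisions :
    Finset ((Fin (p.k + p.ℓ) → F) × (Fin (p.k + p.ℓ) → F)) :=
  collisions A p.ℓ s (p.listD g A 0) (p.listD g A s)

/-- A base vector is generated once and used in two merges, which gives the factor 3. A vector of
`C₀` is stored for both level-1 merges and looked up in one of them; a vector of `Cₛ` is only looked
up. -/
theorem bjmm2_steps :
    (bjmm2 g p A s).steps = 3 * (p.leftSet g).card + 3 * (p.rightSet g).card +
      (p.baseCollisions g A 0).card + (p.baseCollisions g A s).card +
      (3 * (p.listC g A 0).card + (p.listC g A s).card) +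
      (p.middleCollisions g A 0).card + (p.middleCollisions g A s).card +
      ((p.listD g A 0).card + (p.listD g A s).card) +
      (p.finalCollisions g A s).card := by
  have hl : (leftBase g (p.k + p.ℓ) (p.v₂ / 2)).steps = (p.leftSet g).card := by
    change (leftBase g (p.k + p.ℓ) (p.v₂ / 2)).val.length = _
    rw [leftBase_eq, Finset.length_toList]
  have hr : (rightBase g (p.k + p.ℓ) (p.v₂ / 2)).steps = (p.rightSet g).card := by
    change (rightBase g (p.k + p.ℓ) (p.v₂ / 2)).val.length = _
    rw [rightBase_eq, Finset.length_toList]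
  simp only [bjmm2, hl, hr]
  rw [merge_steps _ _ _ _ _ (nodup_merge _ _ _ _ _ _ _) (nodup_merge _ _ _ _ _ _ _),
    merge_steps _ _ _ _ _ (nodup_merge _ _ _ _ _ _ _) (nodup_merge _ _ _ _ _ _ _),
    merge_steps _ _ _ _ _ (nodup_merge _ _ _ _ _ _ _) (nodup_merge _ _ _ _ _ _ _),
    leftBase_eq, rightBase_eq,
    merge_steps _ _ _ _ _ (Finset.nodup_toList _) (Finset.nodup_toList _),
    merge_steps _ _ _ _ _ (Finset.nodup_toList _) (Finset.nodup_toList _)]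
  simp only [merge_val, Finset.toList_toFinset]
  simp only [Params.baseCollisions, Params.middleCollisions, Params.finalCollisions,
    Params.listD, Params.listC]
  ring

end Run


/-! ### Uniformly random matrices -/

section Probability

variable {F : Type*} [Field F] [Fintype F] [DecidableEq F] {m ℓ : ℕ}

/-- The expected value over a uniformly random matrix. -/
noncomputable def mean (f : Matrix (Fin m) (Fin ℓ) F → ℝ) : ℝ :=
  (∑ A, f A) / (Fintype.card (Matrix (Fin m) (Fin ℓ) F) : ℝ)

/-- The probability of an event over a uniformly random matrix. -/
noncomputable def prob (E : Matrix (Fin m) (Fin ℓ) F → Prop) [DecidablePred E] : ℝ :=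
  mean fun A => if E A then 1 else 0

theorem card_matrix_pos : (0 : ℝ) < Fintype.card (Matrix (Fin m) (Fin ℓ) F) :=
  Nat.cast_pos.2 Fintype.card_pos

theorem mean_add (f₁ f₂ : Matrix (Fin m) (Fin ℓ) F → ℝ) :
    mean (fun A => f₁ A + f₂ A) = mean f₁ + mean f₂ := by
  simp only [mean, Finset.sum_add_distrib, add_div]

theorem mean_const_mul (c : ℝ) (f : Matrix (Fin m) (Fin ℓ) F → ℝ) :
    mean (fun A => c * f A) = c * mean f := by
  simp only [mean, ← Finset.mul_sum, mul_div_assoc]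

theorem mean_const (c : ℝ) : mean (fun _ : Matrix (Fin m) (Fin ℓ) F => c) = c := by
  rw [mean, Finset.sum_const, Finset.card_univ, nsmul_eq_mul,
    mul_div_cancel_left₀ _ card_matrix_pos.ne']

theorem mean_mono {f₁ f₂ : Matrix (Fin m) (Fin ℓ) F → ℝ} (h : ∀ A, f₁ A ≤ f₂ A) :
    mean f₁ ≤ mean f₂ := by
  unfold mean
  gcongr
  exact h _

theorem mean_sum {ι : Type*} (S : Finset ι) (f : ι → Matrix (Fin m) (Fin ℓ) F → ℝ) :
    mean (fun A => ∑ i ∈ S, f i A) = ∑ i ∈ S, mean (f i) := by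
  simp only [mean]
  rw [Finset.sum_comm, Finset.sum_div]

/-- The expected number of successes is the sum of the probabilities. -/
theorem mean_card_filter {ι : Type*} (S : Finset ι) (E : ι → Matrix (Fin m) (Fin ℓ) F → Prop)
    [∀ i, DecidablePred (E i)] :
    mean (fun A => ((S.filter fun i => E i A).card : ℝ)) = ∑ i ∈ S, prob (E i) := by
  simp only [prob, ← mean_sum]
  congr 1
  ext A
  simp

theorem prob_nonneg (E : Matrix (Fin m) (Fin ℓ) F → Prop) [DecidablePred E] : 0 ≤ prob E := by
  rw [← mean_const (F := F) (m := m) (ℓ := ℓ) 0]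
  exact mean_mono fun A => by split_ifs <;> norm_num

theorem prob_le_one (E : Matrix (Fin m) (Fin ℓ) F → Prop) [DecidablePred E] : prob E ≤ 1 := by
  rw [← mean_const (F := F) (m := m) (ℓ := ℓ) 1]
  exact mean_mono fun A => by split_ifs <;> norm_num

theorem prob_mono {E₁ E₂ : Matrix (Fin m) (Fin ℓ) F → Prop} [DecidablePred E₁] [DecidablePred E₂]
    (h : ∀ A, E₁ A → E₂ A) : prob E₁ ≤ prob E₂ := by
  refine mean_mono fun A => ?_
  by_cases h1 : E₁ A
  · simp [h1, h A h1]
  · simp only [h1, if_false]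
    split_ifs <;> norm_num

/-- The second moment method: the probability that some event of a family occurs. -/
theorem sq_sum_prob_le {ι : Type*} (S : Finset ι) (E : ι → Matrix (Fin m) (Fin ℓ) F → Prop)
    [∀ i, DecidablePred (E i)] [DecidablePred fun A => ∃ i ∈ S, E i A] :
    (∑ i ∈ S, prob (E i)) ^ 2 ≤
      prob (fun A => ∃ i ∈ S, E i A) * ∑ i ∈ S, ∑ j ∈ S, prob (fun A => E i A ∧ E j A) := by
  have hpos := card_matrix_pos (F := F) (m := m) (ℓ := ℓ)
  have h1 : ∑ i ∈ S, ∑ j ∈ S, prob (fun A => E i A ∧ E j A) =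
      mean (fun A => ((S.filter fun i => E i A).card : ℝ) ^ 2) := by
    simp only [prob, ← mean_sum]
    congr 1
    ext A
    rw [Finset.card_filter, pow_two]
    push_cast
    rw [Finset.sum_mul_sum]
    refine Finset.sum_congr rfl fun i _ => Finset.sum_congr rfl fun j _ => ?_
    by_cases h1 : E i A <;> by_cases h2 : E j A <;> simp [h1, h2]
  rw [h1, ← mean_card_filter, prob]
  simp only [mean]
  rw [div_pow, div_mul_div_comm, pow_two (Fintype.card (Matrix (Fin m) (Fin ℓ) F) : ℝ)]
  gcongr
  -- Cauchy–Schwarz for the indicator that some event occurs and the number of events that occur;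
  -- the indicator leaves this number unchanged.
  have h2 := Finset.sum_mul_sq_le_sq_mul_sq Finset.univ
    (fun A : Matrix (Fin m) (Fin ℓ) F => if ∃ i ∈ S, E i A then (1 : ℝ) else 0)
    (fun A => ((S.filter fun i => E i A).card : ℝ))
  refine le_trans (le_of_eq ?_) (h2.trans (le_of_eq ?_))
  · congr 1
    refine Finset.sum_congr rfl fun A _ => ?_
    by_cases h : ∃ i ∈ S, E i A
    · simp [h]
    · push Not at h
      rw [Finset.filter_false_of_mem h]
      simp
  · simp

/-- The probability `q ^ (-u)` that a non-zero vector agrees with a target on the first `u`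
positions. -/
noncomputable def matchProb (F : Type*) [Fintype F] (ℓ u : ℕ) : ℝ :=
  ((Fintype.card F : ℝ) ^ min u ℓ)⁻¹

theorem matchProb_pos (ℓ u : ℕ) : 0 < matchProb F ℓ u := by
  have : 0 < Fintype.card F := Fintype.card_pos
  unfold matchProb
  positivity

theorem matchProb_le_one (ℓ u : ℕ) : matchProb F ℓ u ≤ 1 := by
  have : 1 ≤ Fintype.card F := Fintype.card_pos
  unfold matchProb
  exact inv_le_one_of_one_le₀ (one_le_pow₀ (by exact_mod_cast this))

theorem prod_ite_lt (c : ℝ) (u : ℕ) :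
    ∏ j : Fin ℓ, (if j.val < u then c else 1) = c ^ min u ℓ := by
  rw [Finset.prod_ite, Finset.prod_const_one, mul_one, Finset.prod_const, Fin.card_filter_val_lt,
    min_comm]

/-- For linearly independent vectors, the events that they agree with their targets are
independent. -/
theorem prob_agrees {r : ℕ} {x : Fin r → Fin m → F} (hx : LinearIndependent F x) (u : Fin r → ℕ)
    (t : Fin r → Fin ℓ → F) :
    prob (fun A : Matrix (Fin m) (Fin ℓ) F => ∀ i, Agrees A (u i) (t i) (x i)) =
      ∏ i, matchProb F ℓ (u i) := by
  classical
  let X : Matrix (Fin r) (Fin m) F := Matrix.of x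
  -- Independent rows give a right inverse, so `A ↦ X * A` is a surjective homomorphism. Its fibres
  -- have equal size, hence `X * A` is uniform and its entries can be counted independently.
  obtain ⟨Y, hY⟩ : ∃ Y : Matrix (Fin m) (Fin r) F, X * Y = 1 := by
    rw [← Matrix.mulVec_surjective_iff_exists_right_inverse]
    change Function.Surjective X.mulVecLin
    rw [← LinearMap.range_eq_top]
    refine Submodule.eq_top_of_finrank_eq ?_
    have h : LinearIndependent F X.row := hx
    rw [← Matrix.rank, h.rank_matrix, Module.finrank_fintype_fun_eq_card]
  let φ : Matrix (Fin m) (Fin ℓ) F →+ Matrix (Fin r) (Fin ℓ) F :=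
    { toFun := fun A => X * A
      map_zero' := Matrix.mul_zero X
      map_add' := Matrix.mul_add X }
  have hφ : Function.Surjective φ := fun B => ⟨Y * B, by
    change X * (Y * B) = B
    rw [← Matrix.mul_assoc, hY, Matrix.one_mul]⟩
  have hfib : ∀ B, (Finset.univ.filter fun A => φ A = B).card =
      (Finset.univ.filter fun A => φ A = 0).card := fun B =>
    AddMonoidHom.card_fiber_eq_of_mem_range φ (hφ B) (hφ 0)
  set K := (Finset.univ.filter fun A => φ A = 0).card with hK
  have hcard : ∀ P : Matrix (Fin r) (Fin ℓ) F → Prop, [DecidablePred P] →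
      (Finset.univ.filter fun A => P (φ A)).card = (Finset.univ.filter P).card * K := by
    intro P _
    rw [Finset.card_eq_sum_card_fiberwise (f := φ) (t := Finset.univ.filter P),
      Finset.sum_congr rfl (g := fun _ => K), Finset.sum_const, smul_eq_mul]
    · intro B hB
      rw [← hfib B, Finset.filter_filter]
      congr 1
      ext A
      simp only [Finset.mem_filter, Finset.mem_univ, true_and] at *
      exact ⟨fun h => h.2, fun h => ⟨h ▸ hB, h⟩⟩
    · intro A hA
      simpa using hA
  have htot := hcard fun _ => True
  have hev := hcard fun B => ∀ i, ∀ j : Fin ℓ, j.val < u i → B i j = t i j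
  have hKpos : 0 < K := Finset.card_pos.2 ⟨0, by simp⟩
  have hset : (Finset.univ.filter fun B : Matrix (Fin r) (Fin ℓ) F =>
      ∀ i, ∀ j : Fin ℓ, j.val < u i → B i j = t i j).card =
      (Fintype.piFinset fun i => Fintype.piFinset fun j : Fin ℓ =>
        if j.val < u i then {t i j} else Finset.univ).card := by
    refine Finset.card_equiv Matrix.of.symm fun B => ?_
    simp only [Finset.mem_filter, Finset.mem_univ, true_and, Fintype.mem_piFinset,
      Matrix.of_symm_apply]
    refine forall_congr' fun i => forall_congr' fun j => ?_
    split_ifs with h <;> simp [h]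
  have hagree : (Finset.univ.filter fun A : Matrix (Fin m) (Fin ℓ) F =>
      ∀ i, Agrees A (u i) (t i) (x i)).card = (Fintype.piFinset fun i =>
        Fintype.piFinset fun j : Fin ℓ => if j.val < u i then {t i j} else Finset.univ).card *
          K := by
    rw [← hset, ← hev]
    congr 1
    ext A
    simp only [Finset.mem_filter, Finset.mem_univ, true_and]
    exact Iff.rfl
  have hq : (Fintype.card F : ℝ) ≠ 0 := Nat.cast_ne_zero.2 Fintype.card_ne_zero
  have hK0 : (K : ℝ) ≠ 0 := Nat.cast_ne_zero.2 hKpos.ne'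
  simp only [Finset.filter_true, Finset.card_univ] at htot
  rw [prob, mean, Finset.sum_boole, htot, hagree,
    Nat.cast_mul, Nat.cast_mul, mul_div_mul_right _ _ hK0, Fintype.card_piFinset]
  have hcard2 : (Fintype.card (Matrix (Fin r) (Fin ℓ) F) : ℝ) =
      ∏ _i : Fin r, ∏ _j : Fin ℓ, (Fintype.card F : ℝ) := by
    rw [Fintype.card_congr (Matrix.of (m := Fin r) (n := Fin ℓ) (α := F)).symm]
    simp
  rw [hcard2]
  push_cast
  rw [← Finset.prod_div_distrib]
  refine Finset.prod_congr rfl fun i _ => ?_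
  rw [Fintype.card_piFinset]
  push_cast
  rw [← Finset.prod_div_distrib, matchProb, ← inv_pow, ← prod_ite_lt]
  refine Finset.prod_congr rfl fun j _ => ?_
  split_ifs with h
  · simp
  · rw [Finset.card_univ, div_self hq]

end Probability


/-! ### Independence, spans and the second moment method -/

section Independent

variable {F : Type*} [Field F] [Fintype F] [DecidableEq F] {m ℓ : ℕ}

theorem Agrees.mono {A : Matrix (Fin m) (Fin ℓ) F} {u u' : ℕ} {t : Fin ℓ → F} {x : Fin m → F}
    (h : Agrees A u t x) (hu : u' ≤ u) : Agrees A u' t x :=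
  fun j hj => h j (hj.trans_le hu)

theorem Agrees.add {A : Matrix (Fin m) (Fin ℓ) F} {u : ℕ} {t t' : Fin ℓ → F} {x x' : Fin m → F}
    (h : Agrees A u t x) (h' : Agrees A u t' x') : Agrees A u (t + t') (x + x') := fun j hj => by
  rw [Matrix.add_vecMul, Pi.add_apply, h j hj, h' j hj, Pi.add_apply]

theorem Agrees.sub {A : Matrix (Fin m) (Fin ℓ) F} {u : ℕ} {t t' : Fin ℓ → F} {x x' : Fin m → F}
    (h : Agrees A u t x) (h' : Agrees A u t' x') : Agrees A u (t - t') (x - x') := fun j hj => by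
  rw [Matrix.sub_vecMul, Pi.sub_apply, h j hj, h' j hj, Pi.sub_apply]

/-- Agreeing on `u` positions and on `u'` positions. -/
theorem Agrees.max {A : Matrix (Fin m) (Fin ℓ) F} {u u' : ℕ} {t : Fin ℓ → F} {x : Fin m → F}
    (h : Agrees A u t x) (h' : Agrees A u' t x) : Agrees A (Max.max u u') t x := fun j hj =>
  (lt_max_iff.1 hj).elim (h j) (h' j)

theorem Agrees.of_length_le {A : Matrix (Fin m) (Fin ℓ) F} {u : ℕ} {t : Fin ℓ → F}
    {x : Fin m → F} (h : Agrees A ℓ t x) : Agrees A u t x := fun j _ => h j j.isLt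

/-- All vectors of a family agree with their targets. -/
def AllAgree {d : ℕ} (A : Matrix (Fin m) (Fin ℓ) F) (u : Fin d → ℕ) (t : Fin d → Fin ℓ → F)
    (v : Fin d → Fin m → F) : Prop :=
  ∀ i, Agrees A (u i) (t i) (v i)

instance {d : ℕ} (A : Matrix (Fin m) (Fin ℓ) F) (u : Fin d → ℕ) (t : Fin d → Fin ℓ → F)
    (v : Fin d → Fin m → F) : Decidable (AllAgree A u t v) := by
  unfold AllAgree
  infer_instance

theorem allAgree_cons {d : ℕ} (A : Matrix (Fin m) (Fin ℓ) F) (u : Fin d → ℕ)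
    (t : Fin d → Fin ℓ → F) (v : Fin d → Fin m → F) (u₀ : ℕ) (t₀ : Fin ℓ → F) (x : Fin m → F) :
    AllAgree A (Fin.cons u₀ u : Fin (d + 1) → ℕ) (Fin.cons t₀ t : Fin (d + 1) → Fin ℓ → F)
      (Fin.cons x v : Fin (d + 1) → Fin m → F) ↔ Agrees A u₀ t₀ x ∧ AllAgree A u t v := by
  simp [AllAgree, Fin.forall_fin_succ]

theorem prob_congr {E₁ E₂ : Matrix (Fin m) (Fin ℓ) F → Prop} [DecidablePred E₁]
    [DecidablePred E₂] (h : ∀ A, E₁ A ↔ E₂ A) : prob E₁ = prob E₂ :=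
  le_antisymm (prob_mono fun A => (h A).1) (prob_mono fun A => (h A).2)

theorem prob_allAgree {d : ℕ} {v : Fin d → Fin m → F} (hv : LinearIndependent F v)
    (u : Fin d → ℕ) (t : Fin d → Fin ℓ → F) :
    prob (fun A : Matrix (Fin m) (Fin ℓ) F => AllAgree A u t v) = ∏ i, matchProb F ℓ (u i) :=
  (prob_congr fun _ => Iff.rfl).trans (prob_agrees hv u t)

/-- A vector outside of the span of a linearly independent family agrees with its target
independently of this family. -/
theorem prob_allAgree_and {d : ℕ} {v : Fin d → Fin m → F} (hv : LinearIndependent F v)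
    (u : Fin d → ℕ) (t : Fin d → Fin ℓ → F) {x : Fin m → F}
    (hx : x ∉ Submodule.span F (Set.range v)) (u₀ : ℕ) (t₀ : Fin ℓ → F) :
    prob (fun A : Matrix (Fin m) (Fin ℓ) F => Agrees A u₀ t₀ x ∧ AllAgree A u t v) =
      matchProb F ℓ u₀ * prob (fun A : Matrix (Fin m) (Fin ℓ) F => AllAgree A u t v) := by
  rw [prob_allAgree hv, ← prob_congr (fun A => allAgree_cons A u t v u₀ t₀ x),
    prob_allAgree (linearIndependent_finCons.2 ⟨hv, hx⟩), Fin.prod_univ_succ]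
  simp

theorem linearIndependent_singleton_vec {x : Fin m → F} (hx : x ≠ 0) :
    LinearIndependent F ![x] :=
  linearIndependent_unique_iff.2 (by simpa using hx)

theorem prob_agrees_of_ne_zero {x : Fin m → F} (hx : x ≠ 0) (u : ℕ) (t : Fin ℓ → F) :
    prob (fun A : Matrix (Fin m) (Fin ℓ) F => Agrees A u t x) = matchProb F ℓ u := by
  have h := prob_allAgree (ℓ := ℓ) (linearIndependent_singleton_vec hx) ![u] ![t]
  rw [prob_congr (E₂ := fun A => Agrees A u t x) (fun A => by simp [AllAgree])] at h
  simpa using h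

theorem prob_agrees_pair {x y : Fin m → F} (hx : x ≠ 0)
    (hy : y ∉ Submodule.span F (Set.range ![x])) (u u' : ℕ) (t t' : Fin ℓ → F) :
    prob (fun A : Matrix (Fin m) (Fin ℓ) F => Agrees A u t x ∧ Agrees A u' t' y) =
      matchProb F ℓ u * matchProb F ℓ u' := by
  have h := prob_allAgree_and (ℓ := ℓ) (linearIndependent_singleton_vec hx) ![u] ![t] hy u' t'
  rw [prob_allAgree (linearIndependent_singleton_vec hx)] at h
  rw [prob_congr (E₂ := fun A => Agrees A u t x ∧ Agrees A u' t' y)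
    (fun A => by simp [AllAgree, and_comm])] at h
  rw [h]
  simp [mul_comm]

/-- A span of `d` vectors has at most `q ^ d` elements. -/
theorem card_filter_mem_span_le {d : ℕ} (v : Fin d → Fin m → F) (S : Finset (Fin m → F))
    [DecidablePred fun x => x ∈ Submodule.span F (Set.range v)] :
    (S.filter fun x => x ∈ Submodule.span F (Set.range v)).card ≤ Fintype.card F ^ d := by
  classical
  have h : (S.filter fun x => x ∈ Submodule.span F (Set.range v)) ⊆
      Finset.univ.image fun c : Fin d → F => ∑ i, c i • v i := by
    intro x hx
    obtain ⟨c, rfl⟩ := (Submodule.mem_span_range_iff_exists_fun F).1 (Finset.mem_filter.1 hx).2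
    exact Finset.mem_image_of_mem _ (Finset.mem_univ _)
  refine (Finset.card_le_card h).trans (Finset.card_image_le.trans ?_)
  simp

open Classical in
theorem card_filter_notMem_span_ge {d : ℕ} (v : Fin d → Fin m → F) (S : Finset (Fin m → F)) :
    (S.card : ℝ) - (Fintype.card F : ℝ) ^ d ≤
      ((S.filter fun x => x ∉ Submodule.span F (Set.range v)).card : ℝ) := by
  have h1 := card_filter_mem_span_le v S
  have h2 := Finset.card_filter_add_card_filter_not (s := S)
    (fun x => x ∈ Submodule.span F (Set.range v))
  have h3 : (S.card : ℝ) ≤ (Fintype.card F : ℝ) ^ d +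
      ((S.filter fun x => x ∉ Submodule.span F (Set.range v)).card : ℝ) := by
    rw [← h2]
    push_cast
    gcongr
    exact_mod_cast h1
  linarith

/-- Vectors outside of the span agree independently of the family; the at most `q ^ d` vectors in
the span are bounded trivially by `P`. -/
theorem sum_prob_agrees_le {d : ℕ} {v : Fin d → Fin m → F} (hv : LinearIndependent F v)
    (u : Fin d → ℕ) (t : Fin d → Fin ℓ → F) (u₀ : ℕ) (S : Finset (Fin m → F)) :
    ∑ x ∈ S, prob (fun A : Matrix (Fin m) (Fin ℓ) F => Agrees A u₀ 0 x ∧ AllAgree A u t v) ≤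
      prob (fun A : Matrix (Fin m) (Fin ℓ) F => AllAgree A u t v) *
        (S.card * matchProb F ℓ u₀ + (Fintype.card F : ℝ) ^ d) := by
  classical
  set P := prob (fun A : Matrix (Fin m) (Fin ℓ) F => AllAgree A u t v)
  have hP : 0 ≤ P := prob_nonneg _
  calc _ ≤ ∑ x ∈ S, P * (matchProb F ℓ u₀ +
        if x ∈ Submodule.span F (Set.range v) then 1 else 0) := by
        refine Finset.sum_le_sum fun x _ => ?_
        by_cases hx : x ∈ Submodule.span F (Set.range v)
        · rw [if_pos hx]
          have h1 := prob_mono (F := F) (m := m) (ℓ := ℓ)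
            (E₁ := fun A => Agrees A u₀ 0 x ∧ AllAgree A u t v)
            (E₂ := fun A => AllAgree A u t v) fun A h => h.2
          have h2 := (matchProb_pos (F := F) ℓ u₀).le
          nlinarith
        · rw [if_neg hx, prob_allAgree_and hv u t hx]
          linarith
    _ = P * (S.card * matchProb F ℓ u₀ +
        ((S.filter fun x => x ∈ Submodule.span F (Set.range v)).card : ℝ)) := by
        rw [← Finset.mul_sum, Finset.sum_add_distrib]
        simp
    _ ≤ _ := by
        gcongr
        exact_mod_cast card_filter_mem_span_le v S

/-- If `x` is outside of the span, it joins the family and the single-sum bound applies to `x'` with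
`d + 1` vectors; if it is inside, its own condition is dropped, which happens for at most `q ^ d`
values of `x`. -/
theorem sum_sum_prob_agrees_le {d : ℕ} {v : Fin d → Fin m → F} (hv : LinearIndependent F v)
    (u : Fin d → ℕ) (t : Fin d → Fin ℓ → F) (u₀ r : ℕ) {S S' : Finset (Fin m → F)}
    (hS : S.card = r) (hS' : S'.card = r) :
    ∑ x ∈ S, ∑ x' ∈ S', prob (fun A : Matrix (Fin m) (Fin ℓ) F =>
        Agrees A u₀ 0 x' ∧ Agrees A u₀ 0 x ∧ AllAgree A u t v) ≤
      prob (fun A : Matrix (Fin m) (Fin ℓ) F => AllAgree A u t v) *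
        (r * matchProb F ℓ u₀ + (Fintype.card F : ℝ) ^ (d + 1)) ^ 2 := by
  classical
  set P := prob (fun A : Matrix (Fin m) (Fin ℓ) F => AllAgree A u t v)
  have hP : 0 ≤ P := prob_nonneg _
  have hψ := (matchProb_pos (F := F) ℓ u₀).le
  have hq : (1 : ℝ) ≤ Fintype.card F := by exact_mod_cast Fintype.card_pos (α := F)
  have hq2 : (Fintype.card F : ℝ) ^ d ≤ (Fintype.card F : ℝ) ^ (d + 1) :=
    pow_le_pow_right₀ hq (Nat.le_succ d)
  set X := r * matchProb F ℓ u₀ + (Fintype.card F : ℝ) ^ (d + 1) with hX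
  have hX0 : 0 ≤ X := by positivity
  calc _ ≤ ∑ x ∈ S, P * X * (matchProb F ℓ u₀ +
        if x ∈ Submodule.span F (Set.range v) then 1 else 0) := by
        refine Finset.sum_le_sum fun x _ => ?_
        by_cases hx : x ∈ Submodule.span F (Set.range v)
        · rw [if_pos hx]
          calc _ ≤ ∑ x' ∈ S', prob (fun A : Matrix (Fin m) (Fin ℓ) F =>
                Agrees A u₀ 0 x' ∧ AllAgree A u t v) :=
                Finset.sum_le_sum fun x' _ => prob_mono fun A h => ⟨h.1, h.2.2⟩
            _ ≤ P * (r * matchProb F ℓ u₀ + (Fintype.card F : ℝ) ^ d) := by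
                rw [← hS']
                exact sum_prob_agrees_le hv u t u₀ S'
            _ ≤ P * X * 1 := by
                rw [mul_one]
                exact mul_le_mul_of_nonneg_left (by linarith) hP
            _ ≤ _ := by
                gcongr
                linarith
        · rw [if_neg hx]
          have h := sum_prob_agrees_le (ℓ := ℓ) (linearIndependent_finCons.2 ⟨hv, hx⟩)
            (Fin.cons u₀ u : Fin (d + 1) → ℕ) (Fin.cons 0 t : Fin (d + 1) → Fin ℓ → F) u₀ S'
          rw [prob_congr (fun A => allAgree_cons A u t v u₀ 0 x), prob_allAgree_and hv u t hx,
            hS'] at h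
          refine le_trans (le_of_eq (Finset.sum_congr rfl fun x' _ => prob_congr fun A => ?_))
            (h.trans (le_of_eq ?_))
          · rw [allAgree_cons]
          · ring
    _ = P * X * (r * matchProb F ℓ u₀ +
        ((S.filter fun x => x ∈ Submodule.span F (Set.range v)).card : ℝ)) := by
        rw [← Finset.mul_sum, Finset.sum_add_distrib]
        simp [hS]
    _ ≤ P * X * X := by
        have h : ((S.filter fun x => x ∈ Submodule.span F (Set.range v)).card : ℝ) ≤
            (Fintype.card F : ℝ) ^ d := by
          exact_mod_cast card_filter_mem_span_le v S
        exact mul_le_mul_of_nonneg_left (by linarith) (by positivity)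
    _ = _ := by ring

open Classical in
/-- The probability that some pair of vectors agrees with zero, together with a linearly
independent family that agrees with its targets. -/
theorem prob_exists_pair_ge {d : ℕ} {v : Fin d → Fin m → F} (hv : LinearIndependent F v)
    (u : Fin d → ℕ) (t : Fin d → Fin ℓ → F) (u₀ r : ℕ) {S S' : Finset (Fin m → F)}
    (hS : S.card = r) (hS' : S'.card = r)
    (hr : 2 * (Fintype.card F : ℝ) ^ (d + 1) ≤ r) :
    prob (fun A : Matrix (Fin m) (Fin ℓ) F => AllAgree A u t v) *
      ((r * matchProb F ℓ u₀) ^ 2 / 4 /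
        (r * matchProb F ℓ u₀ + (Fintype.card F : ℝ) ^ (d + 3)) ^ 2) ≤
    prob (fun A : Matrix (Fin m) (Fin ℓ) F => ∃ x ∈ S, ∃ x' ∈ S',
      Agrees A u₀ 0 x' ∧ Agrees A u₀ 0 x ∧ AllAgree A u t v) := by
  set P := prob (fun A : Matrix (Fin m) (Fin ℓ) F => AllAgree A u t v) with hPdef
  have hPpos : 0 < P := by
    rw [hPdef, prob_allAgree hv]
    exact Finset.prod_pos fun i _ => matchProb_pos _ _
  set ψ := matchProb F ℓ u₀ with hψdef
  have hψ : 0 < ψ := matchProb_pos ℓ u₀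
  have hq : (1 : ℝ) ≤ Fintype.card F := by exact_mod_cast Fintype.card_pos (α := F)
  have hq2 : (Fintype.card F : ℝ) ^ d ≤ (Fintype.card F : ℝ) ^ (d + 1) :=
    pow_le_pow_right₀ hq (Nat.le_succ d)
  have hqpos : (0 : ℝ) < (Fintype.card F : ℝ) ^ (d + 3) := by positivity
  -- Only pairs that extend the family to a linearly independent one are counted, so that the first
  -- moment is exact.
  let T : Finset ((Fin m → F) × (Fin m → F)) :=
    (S.filter fun x => x ∉ Submodule.span F (Set.range v)).biUnion fun x =>
      (S'.filter fun x' => x' ∉ Submodule.span F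
        (Set.range (Fin.cons x v : Fin (d + 1) → Fin m → F))).image fun x' => (x, x')
  have hT : ∀ p, p ∈ T ↔ (p.1 ∈ S ∧ p.1 ∉ Submodule.span F (Set.range v)) ∧ p.2 ∈ S' ∧
      p.2 ∉ Submodule.span F (Set.range (Fin.cons p.1 v : Fin (d + 1) → Fin m → F)) := by
    rintro ⟨x, x'⟩
    simp only [T, Finset.mem_biUnion, Finset.mem_filter, Finset.mem_image, Prod.mk.injEq]
    constructor
    · rintro ⟨y, hy, y', hy', rfl, rfl⟩
      exact ⟨hy, hy'⟩
    · rintro ⟨hy, hy'⟩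
      exact ⟨x, hy, x', hy', rfl, rfl⟩
  -- Each of the two choices avoids a span of at most `q ^ (d + 1) ≤ r / 2` elements, so at least
  -- half of the candidates remain each time.
  have hTcard : (r : ℝ) ^ 2 / 4 ≤ T.card := by
    rw [Finset.card_biUnion]
    · push_cast
      have h1 : ∀ x ∈ S.filter fun x => x ∉ Submodule.span F (Set.range v), (r : ℝ) / 2 ≤
          (((S'.filter fun x' => x' ∉ Submodule.span F
            (Set.range (Fin.cons x v : Fin (d + 1) → Fin m → F))).image
              fun x' => (x, x')).card : ℝ) := by
        intro x _
        rw [Finset.card_image_of_injective _ (Prod.mk_right_injective x)]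
        have := card_filter_notMem_span_ge (Fin.cons x v : Fin (d + 1) → Fin m → F) S'
        rw [hS'] at this
        linarith
      have h2 := card_filter_notMem_span_ge v S
      rw [hS] at h2
      refine le_trans ?_ (Finset.card_nsmul_le_sum _ _ _ h1)
      rw [nsmul_eq_mul]
      nlinarith
    · intro x _ y _ hxy
      rw [Function.onFun, Finset.disjoint_left]
      rintro p hp hp'
      simp only [Finset.mem_image] at hp hp'
      obtain ⟨a, -, rfl⟩ := hp
      obtain ⟨b, -, hb⟩ := hp'
      exact hxy (Prod.ext_iff.1 hb).1.symm
  let E : (Fin m → F) × (Fin m → F) → Matrix (Fin m) (Fin ℓ) F → Prop := fun p A =>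
    Agrees A u₀ 0 p.2 ∧ Agrees A u₀ 0 p.1 ∧ AllAgree A u t v
  have hind : ∀ p ∈ T, LinearIndependent F
      (Fin.cons p.2 (Fin.cons p.1 v : Fin (d + 1) → Fin m → F) : Fin (d + 1 + 1) → Fin m → F) := by
    intro p hp
    rw [hT] at hp
    exact linearIndependent_finCons.2 ⟨linearIndependent_finCons.2 ⟨hv, hp.1.2⟩, hp.2.2⟩
  have hEiff : ∀ p A, E p A ↔ AllAgree A
      (Fin.cons u₀ (Fin.cons u₀ u : Fin (d + 1) → ℕ) : Fin (d + 1 + 1) → ℕ)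
      (Fin.cons 0 (Fin.cons 0 t : Fin (d + 1) → Fin ℓ → F) : Fin (d + 1 + 1) → Fin ℓ → F)
      (Fin.cons p.2 (Fin.cons p.1 v : Fin (d + 1) → Fin m → F) : Fin (d + 1 + 1) → Fin m → F) := by
    intro p A
    rw [allAgree_cons, allAgree_cons]
  have hE : ∀ p ∈ T, prob (E p) = P * ψ ^ 2 := by
    intro p hp
    rw [prob_congr (hEiff p), prob_allAgree (hind p hp), Fin.prod_univ_succ, Fin.prod_univ_succ,
      hPdef, prob_allAgree hv]
    simp only [Fin.cons_zero, Fin.cons_succ]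
    ring
  -- Given the event of one pair, the family has `d + 2` vectors; the double sum bound for this
  -- family produces the exponent `d + 3`.
  have hEE : ∀ p ∈ T, ∑ p' ∈ T, prob (fun A => E p A ∧ E p' A) ≤
      P * ψ ^ 2 * (r * ψ + (Fintype.card F : ℝ) ^ (d + 3)) ^ 2 := by
    intro p hp
    have h := sum_sum_prob_agrees_le (ℓ := ℓ) (hind p hp)
      (Fin.cons u₀ (Fin.cons u₀ u : Fin (d + 1) → ℕ) : Fin (d + 1 + 1) → ℕ)
      (Fin.cons 0 (Fin.cons 0 t : Fin (d + 1) → Fin ℓ → F) : Fin (d + 1 + 1) → Fin ℓ → F)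
      u₀ r hS hS'
    rw [← prob_congr (hEiff p), hE p hp, ← Finset.sum_product'] at h
    refine le_trans ?_ h
    refine le_trans (Finset.sum_le_sum fun p' _ => prob_mono (E₂ := fun A =>
      Agrees A u₀ 0 p'.2 ∧ Agrees A u₀ 0 p'.1 ∧ AllAgree A
      (Fin.cons u₀ (Fin.cons u₀ u : Fin (d + 1) → ℕ) : Fin (d + 1 + 1) → ℕ)
      (Fin.cons 0 (Fin.cons 0 t : Fin (d + 1) → Fin ℓ → F) : Fin (d + 1 + 1) → Fin ℓ → F)
      (Fin.cons p.2 (Fin.cons p.1 v : Fin (d + 1) → Fin m → F) : Fin (d + 1 + 1) → Fin m → F))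
      fun A h => ⟨h.2.1, h.2.2.1, (hEiff p A).1 h.1⟩) ?_
    refine Finset.sum_le_sum_of_subset_of_nonneg (fun p' hp' => ?_) fun _ _ _ => prob_nonneg _
    rw [hT] at hp'
    exact Finset.mem_product.2 ⟨hp'.1.1, hp'.2.1⟩
  have hmain := sq_sum_prob_le T E
  rw [Finset.sum_congr rfl hE, Finset.sum_const, nsmul_eq_mul] at hmain
  have hsum : ∑ p ∈ T, ∑ p' ∈ T, prob (fun A => E p A ∧ E p' A) ≤
      T.card * (P * ψ ^ 2 * (r * ψ + (Fintype.card F : ℝ) ^ (d + 3)) ^ 2) := by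
    refine (Finset.sum_le_sum hEE).trans (le_of_eq ?_)
    rw [Finset.sum_const, nsmul_eq_mul]
  set Y := (r * ψ + (Fintype.card F : ℝ) ^ (d + 3)) ^ 2 with hY
  have hYpos : 0 < Y := by positivity
  have hprob : prob (fun A => ∃ p ∈ T, E p A) ≤ prob (fun A : Matrix (Fin m) (Fin ℓ) F =>
      ∃ x ∈ S, ∃ x' ∈ S', Agrees A u₀ 0 x' ∧ Agrees A u₀ 0 x ∧ AllAgree A u t v) := by
    refine prob_mono fun A => ?_
    rintro ⟨p, hp, hE⟩
    rw [hT] at hp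
    exact ⟨p.1, hp.1.1, p.2, hp.2.1, hE⟩
  refine le_trans ?_ hprob
  set W := prob (fun A => ∃ p ∈ T, E p A)
  have hW : 0 ≤ W := prob_nonneg _
  have hrpos : (0 : ℝ) < r := lt_of_lt_of_le (by positivity) hr
  have hTpos : (0 : ℝ) < T.card := lt_of_lt_of_le (by positivity) hTcard
  -- One factor of the first moment is cancelled from the second moment inequality, which leaves
  -- `T.card * (P * ψ ^ 2) ≤ W * Y`.
  have h3 : (T.card * (P * ψ ^ 2)) * (T.card * (P * ψ ^ 2)) ≤
      (T.card * (P * ψ ^ 2)) * (W * Y) := by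
    calc _ = (T.card * (P * ψ ^ 2)) ^ 2 := by ring
      _ ≤ W * (T.card * (P * ψ ^ 2 * Y)) := hmain.trans (by gcongr)
      _ = _ := by ring
  have h4 := le_of_mul_le_mul_left h3 (by positivity)
  rw [← mul_div_assoc, div_le_iff₀ hYpos]
  refine le_trans ?_ h4
  calc P * ((r * ψ) ^ 2 / 4) = (r : ℝ) ^ 2 / 4 * (P * ψ ^ 2) := by ring
    _ ≤ _ := by gcongr

end Independent


/-! ### Bounds for the enumeration cost -/

section Pairs

variable {F : Type*} [Field F] [Fintype F] [DecidableEq F] {g : F} {m ℓ : ℕ}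

open Classical in
/-- The pairs of linearly independent vectors of a set (of non-zero vectors). -/
noncomputable def independentPairs (S : Finset (Fin m → F)) :
    Finset ((Fin m → F) × (Fin m → F)) :=
  (S ×ˢ S).filter fun p => p.2 ∉ Submodule.span F (Set.range ![p.1])

theorem mem_independentPairs {S : Finset (Fin m → F)} {p : (Fin m → F) × (Fin m → F)} :
    p ∈ independentPairs S ↔ (p.1 ∈ S ∧ p.2 ∈ S) ∧ p.2 ∉ Submodule.span F (Set.range ![p.1]) := by
  simp only [independentPairs, Finset.mem_filter, Finset.mem_product]

/-- All vectors of `S` have the same weight: if the first were zero, so would be the second, which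
would then lie in the span. -/
theorem fst_ne_zero_of_mem_independentPairs {S : Finset (Fin m → F)} {w : ℕ}
    (hS : S ⊆ wellFormed g m w) {p : (Fin m → F) × (Fin m → F)} (hp : p ∈ independentPairs S) :
    p.1 ≠ 0 := by
  rw [mem_independentPairs] at hp
  intro h0
  have h1 := hS hp.1.1
  have h2 := hS hp.1.2
  simp only [wellFormed, Finset.mem_filter] at h1 h2
  have h3 : hammingNorm p.2 = 0 := by rw [h2.2.2, ← h1.2.2, h0, hammingNorm_zero]
  rw [hammingNorm_eq_zero] at h3
  exact hp.2 (h3 ▸ Submodule.zero_mem _)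

/-- The pair `(x, y)` is replaced by `(x, x + y)`, since the conditions of a merge concern `x` and
`x + y`. -/
theorem add_notMem_span {x y : Fin m → F} (h : y ∉ Submodule.span F (Set.range ![x])) :
    x + y ∉ Submodule.span F (Set.range ![x]) := by
  have hx : x ∈ Submodule.span F (Set.range ![x]) := Submodule.subset_span ⟨0, rfl⟩
  rwa [Submodule.add_mem_iff_right _ hx]

theorem prob_independentPair {S : Finset (Fin m → F)} {w : ℕ}
    (hS : S ⊆ wellFormed g m w) {p : (Fin m → F) × (Fin m → F)} (hp : p ∈ independentPairs S)
    (u u' : ℕ) (t : Fin ℓ → F) :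
    prob (fun A : Matrix (Fin m) (Fin ℓ) F => Agrees A u 0 p.1 ∧ Agrees A u' t (p.1 + p.2)) =
      matchProb F ℓ u * matchProb F ℓ u' :=
  prob_agrees_pair (fst_ne_zero_of_mem_independentPairs hS hp)
    (add_notMem_span (mem_independentPairs.1 hp).2) u u' 0 t

theorem card_independentPairs_le (S : Finset (Fin m → F)) :
    ((independentPairs S).card : ℝ) ≤ (S.card : ℝ) ^ 2 := by
  classical
  have h := Finset.card_filter_le (S ×ˢ S) fun p => p.2 ∉ Submodule.span F (Set.range ![p.1])
  rw [Finset.card_product] at h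
  rw [pow_two]
  exact_mod_cast h

/-- For each first vector, at most `q` second vectors lie on its line. -/
theorem card_independentPairs_ge (S : Finset (Fin m → F)) :
    (S.card : ℝ) * (S.card - Fintype.card F) ≤ (independentPairs S).card := by
  classical
  rw [independentPairs, Finset.card_filter, Finset.sum_product]
  push_cast
  rw [← nsmul_eq_mul]
  refine Finset.card_nsmul_le_sum _ _ _ fun x _ => ?_
  have h := card_filter_notMem_span_ge ![x] S
  rw [pow_one, Finset.card_filter] at h
  push_cast at h
  exact h

/-- The pairs of a collision that are linearly dependent are few. -/
theorem card_collisions_le {A : Matrix (Fin m) (Fin ℓ) F} {u u' w : ℕ} {t : Fin ℓ → F}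
    {S T : Finset (Fin m → F)} (hS : ∀ x ∈ S, x ∈ wellFormed g m w ∧ Agrees A u 0 x)
    (hT : ∀ x ∈ T, x ∈ wellFormed g m w ∧ Agrees A u t x) :
    (collisions A u' t S T).card ≤ Fintype.card F * S.card +
      ((independentPairs (wellFormed g m w)).filter fun p =>
        Agrees A u 0 p.1 ∧ Agrees A (max u u') t (p.1 + p.2)).card := by
  classical
  have h : collisions A u' t S T ⊆
      ((Finset.univ ×ˢ S).image fun c : F × (Fin m → F) => (c.2, c.1 • c.2)) ∪
      ((independentPairs (wellFormed g m w)).filter fun p =>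
        Agrees A u 0 p.1 ∧ Agrees A (max u u') t (p.1 + p.2)) := by
    rintro ⟨x, y⟩ hp
    simp only [collisions, Finset.mem_filter, Finset.mem_product] at hp
    obtain ⟨⟨hx, hy⟩, hxy⟩ := hp
    rw [Finset.mem_union]
    by_cases hspan : y ∈ Submodule.span F (Set.range ![x])
    · left
      rw [Submodule.mem_span_range_iff_exists_fun] at hspan
      obtain ⟨c, hc⟩ := hspan
      rw [Finset.mem_image]
      refine ⟨(c 0, x), by simpa using hx, ?_⟩
      simpa using hc
    · right
      rw [Finset.mem_filter, mem_independentPairs]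
      -- The sum agrees on `u` positions because both summands do, and on `u'` positions because the
      -- pair collides.
      refine ⟨⟨⟨(hS x hx).1, (hT y hy).1⟩, hspan⟩, (hS x hx).2, Agrees.max ?_ hxy⟩
      simpa using (hS x hx).2.add (hT y hy).2
  refine (Finset.card_le_card h).trans ((Finset.card_union_le _ _).trans ?_)
  gcongr
  refine Finset.card_image_le.trans (le_of_eq ?_)
  rw [Finset.card_product, Finset.card_univ]

theorem mean_independentPairs_le (g : F) (m ℓ w u u' : ℕ) (t : Fin ℓ → F) :
    mean (fun A : Matrix (Fin m) (Fin ℓ) F =>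
      (((independentPairs (wellFormed g m w)).filter fun p =>
        Agrees A u 0 p.1 ∧ Agrees A u' t (p.1 + p.2)).card : ℝ)) ≤
      ((wellFormed g m w).card : ℝ) ^ 2 * (matchProb F ℓ u * matchProb F ℓ u') := by
  rw [mean_card_filter, Finset.sum_congr rfl fun p hp =>
    prob_independentPair (Finset.Subset.refl _) hp u u' t, Finset.sum_const, nsmul_eq_mul]
  have h1 := matchProb_pos (F := F) ℓ u
  have h2 := matchProb_pos (F := F) ℓ u'
  gcongr
  exact card_independentPairs_le _

/-- For fixed lists only the sum matters, and it vanishes for at most one `y` per `x`; this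
exception gives the term `S.card`. -/
theorem mean_collisions_le (S T : Finset (Fin m → F)) (u : ℕ) (t : Fin ℓ → F) :
    mean (fun A : Matrix (Fin m) (Fin ℓ) F => ((collisions A u t S T).card : ℝ)) ≤
      S.card + S.card * T.card * matchProb F ℓ u := by
  have hψ := (matchProb_pos (F := F) ℓ u).le
  simp only [collisions]
  rw [mean_card_filter, Finset.sum_product]
  calc _ ≤ ∑ _x ∈ S, (1 + T.card * matchProb F ℓ u) := by
        refine Finset.sum_le_sum fun x _ => ?_
        calc _ ≤ ∑ y ∈ T, ((if y = -x then 1 else 0) + matchProb F ℓ u) := by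
              refine Finset.sum_le_sum fun y _ => ?_
              by_cases h : x + y = 0
              · rw [if_pos (by rw [eq_neg_iff_add_eq_zero, add_comm, h])]
                linarith [prob_le_one fun A : Matrix (Fin m) (Fin ℓ) F => Agrees A u t (x + y)]
              · rw [if_neg (by rwa [eq_neg_iff_add_eq_zero, add_comm]),
                  prob_agrees_of_ne_zero h, zero_add]
          _ ≤ _ := by
              rw [Finset.sum_add_distrib, Finset.sum_const, nsmul_eq_mul,
                Finset.sum_ite_eq']
              gcongr
              split_ifs <;> norm_num
    _ = _ := by
        rw [Finset.sum_const, nsmul_eq_mul]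
        ring

end Pairs

/-! ### Upper and lower bounds for the cost at given parameters -/

section Cost

variable {F : Type*} [Field F] [Fintype F] [DecidableEq F] {g : F} {p : Params}
  {A : Matrix (Fin (p.k + p.ℓ)) (Fin p.ℓ) F}

theorem enumCost_eq_mean (s : Fin p.ℓ → F) :
    enumCost g p s = mean fun A => ((bjmm2 g p A s).steps : ℝ) := rfl

theorem mem_mergeSet {m ℓ : ℕ} {A : Matrix (Fin m) (Fin ℓ) F} {u w : ℕ} {t : Fin ℓ → F}
    {S T : Finset (Fin m → F)} {x : Fin m → F} :
    x ∈ mergeSet g A u t w S T ↔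
      (∃ y ∈ S, ∃ z ∈ T, Agrees A u t (y + z) ∧ y + z = x) ∧ x ∈ wellFormed g m w := by
  simp only [mergeSet, collisions, Finset.mem_inter, Finset.mem_image, Finset.mem_filter,
    Finset.mem_product, Prod.exists]
  constructor
  · rintro ⟨⟨y, z, ⟨⟨hy, hz⟩, h⟩, rfl⟩, hx⟩
    exact ⟨⟨y, hy, z, hz, h, rfl⟩, hx⟩
  · rintro ⟨⟨y, hy, z, hz, h, rfl⟩, hx⟩
    exact ⟨⟨y, z, ⟨⟨hy, hz⟩, h⟩, rfl⟩, hx⟩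

theorem agrees_of_mem_mergeSet {m ℓ : ℕ} {A : Matrix (Fin m) (Fin ℓ) F} {u w : ℕ}
    {t : Fin ℓ → F} {S T : Finset (Fin m → F)} {x : Fin m → F}
    (hx : x ∈ mergeSet g A u t w S T) : x ∈ wellFormed g m w ∧ Agrees A u t x := by
  rw [mem_mergeSet] at hx
  obtain ⟨⟨y, -, z, -, h, rfl⟩, hx⟩ := hx
  exact ⟨hx, h⟩

theorem card_mergeSet_le {m ℓ : ℕ} {A : Matrix (Fin m) (Fin ℓ) F} {u w : ℕ}
    {t : Fin ℓ → F} {S T : Finset (Fin m → F)} :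
    (mergeSet g A u t w S T).card ≤ (collisions A u t S T).card :=
  (Finset.card_le_card Finset.inter_subset_left).trans Finset.card_image_le

/-- The size of a base list. -/
noncomputable def Params.baseSize (p : Params) (g : F) : ℕ := (p.leftSet g).card

theorem card_rightSet (hg : g ≠ 0) (hp : p.Admissible g) :
    (p.rightSet g).card = p.baseSize g := by
  obtain ⟨M, hM⟩ := hp.even_length
  rw [Params.baseSize, card_splitVectors hg (M := M) (by omega),
    card_splitVectors hg (M := M) (by omega), mul_comm]

/-- List sizes are bounded by the collisions that produce them, and collisions by `q` times the
first list plus the independent pairs. Unrolling this through both levels costs a factor quadratic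
in `q`; `(q + 10) ^ 2` dominates all coefficients. -/
theorem enumCost_le (hg : g ≠ 0) (hp : p.Admissible g) (s : Fin p.ℓ → F) :
    enumCost g p s ≤ ((Fintype.card F : ℝ) + 10) ^ 2 *
      (p.baseSize g + (p.baseSize g : ℝ) ^ 2 * matchProb F p.ℓ (p.u₁ g) +
      ((wellFormed g (p.k + p.ℓ) p.v₂).card : ℝ) ^ 2 *
        (matchProb F p.ℓ (p.u₁ g) * matchProb F p.ℓ (max (p.u₁ g) (p.u₀ g))) +
      ((wellFormed g (p.k + p.ℓ) p.v₁).card : ℝ) ^ 2 *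
        (matchProb F p.ℓ (p.u₀ g) * matchProb F p.ℓ (max (p.u₀ g) p.ℓ))) := by
  set q : ℝ := (Fintype.card F : ℝ) with hq
  have hq0 : 0 ≤ q := Nat.cast_nonneg _
  set b : ℝ := (p.baseSize g : ℝ) with hb
  let I : Matrix (Fin (p.k + p.ℓ)) (Fin p.ℓ) F → (Fin p.ℓ → F) → ℕ := fun A t =>
    ((independentPairs (wellFormed g (p.k + p.ℓ) p.v₂)).filter fun x =>
      Agrees A (p.u₁ g) 0 x.1 ∧ Agrees A (max (p.u₁ g) (p.u₀ g)) t (x.1 + x.2)).card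
  let J : Matrix (Fin (p.k + p.ℓ)) (Fin p.ℓ) F → ℕ := fun A =>
    ((independentPairs (wellFormed g (p.k + p.ℓ) p.v₁)).filter fun x =>
      Agrees A (p.u₀ g) 0 x.1 ∧ Agrees A (max (p.u₀ g) p.ℓ) s (x.1 + x.2)).card
  have hsteps : ∀ A, ((bjmm2 g p A s).steps : ℝ) ≤ (6 * b + (4 + (q + 4) * q) *
      ((p.baseCollisions g A 0).card : ℝ)) + (2 * ((p.baseCollisions g A s).card : ℝ) +
      ((q + 2) * (I A 0 : ℝ) + (2 * (I A s : ℝ) + (J A : ℝ)))) := by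
    intro A
    have hC : ∀ t, ((p.listC g A t).card : ℝ) ≤ (p.baseCollisions g A t).card := fun t => by
      exact_mod_cast card_mergeSet_le
    have hM : ∀ t, ((p.middleCollisions g A t).card : ℝ) ≤
        q * (p.listC g A 0).card + I A t := fun t => by
      have h : (p.middleCollisions g A t).card ≤
          Fintype.card F * (p.listC g A 0).card + I A t :=
        card_collisions_le (fun _ hx => agrees_of_mem_mergeSet hx)
          (fun _ hx => agrees_of_mem_mergeSet hx)
      rw [hq]
      exact_mod_cast h
    have hD : ∀ t, ((p.listD g A t).card : ℝ) ≤ (p.middleCollisions g A t).card := fun t => by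
      exact_mod_cast card_mergeSet_le
    have hF : ((p.finalCollisions g A s).card : ℝ) ≤ q * (p.listD g A 0).card + J A := by
      have h : (p.finalCollisions g A s).card ≤
          Fintype.card F * (p.listD g A 0).card + J A :=
        card_collisions_le (fun _ hx => agrees_of_mem_mergeSet hx)
          (fun _ hx => agrees_of_mem_mergeSet hx)
      rw [hq]
      exact_mod_cast h
    rw [bjmm2_steps, card_rightSet hg hp]
    push_cast
    have hb' : ((p.leftSet g).card : ℝ) = b := rfl
    rw [hb', ← hb]
    have h1 := mul_le_mul_of_nonneg_left (hC 0) hq0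
    have h2 := mul_le_mul_of_nonneg_left ((hD 0).trans (hM 0)) hq0
    have h3 := mul_le_mul_of_nonneg_left h1 hq0
    nlinarith [hC 0, hC s, hM 0, hM s, hD 0, hD s, hF]
  have hbase : ∀ t, mean (fun A => ((p.baseCollisions g A t).card : ℝ)) ≤
      b + b ^ 2 * matchProb F p.ℓ (p.u₁ g) := by
    intro t
    refine (mean_collisions_le _ _ _ _).trans (le_of_eq ?_)
    rw [card_rightSet hg hp]
    change b + b * b * _ = _
    ring
  have hI : ∀ t, mean (fun A => (I A t : ℝ)) ≤ _ := fun t =>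
    mean_independentPairs_le g (p.k + p.ℓ) p.ℓ p.v₂ (p.u₁ g) (max (p.u₁ g) (p.u₀ g)) t
  have hJ : mean (fun A => (J A : ℝ)) ≤ _ :=
    mean_independentPairs_le g (p.k + p.ℓ) p.ℓ p.v₁ (p.u₀ g) (max (p.u₀ g) p.ℓ) s
  rw [enumCost_eq_mean]
  refine (mean_mono hsteps).trans ?_
  rw [mean_add, mean_add, mean_const, mean_const_mul, mean_add, mean_const_mul, mean_add,
    mean_const_mul, mean_add, mean_const_mul]
  have hb0 : 0 ≤ b := Nat.cast_nonneg _
  have hx0 : 0 ≤ b ^ 2 * matchProb F p.ℓ (p.u₁ g) :=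
    mul_nonneg (sq_nonneg _) (matchProb_pos _ _).le
  have hN0 : 0 ≤ ((wellFormed g (p.k + p.ℓ) p.v₂).card : ℝ) ^ 2 *
      (matchProb F p.ℓ (p.u₁ g) * matchProb F p.ℓ (max (p.u₁ g) (p.u₀ g))) :=
    mul_nonneg (sq_nonneg _) (mul_nonneg (matchProb_pos _ _).le (matchProb_pos _ _).le)
  have hN1 : 0 ≤ ((wellFormed g (p.k + p.ℓ) p.v₁).card : ℝ) ^ 2 *
      (matchProb F p.ℓ (p.u₀ g) * matchProb F p.ℓ (max (p.u₀ g) p.ℓ)) :=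
    mul_nonneg (sq_nonneg _) (mul_nonneg (matchProb_pos _ _).le (matchProb_pos _ _).le)
  have h1 := mul_le_mul_of_nonneg_left (hbase 0) (by positivity : 0 ≤ 4 + (q + 4) * q)
  have h2 := mul_le_mul_of_nonneg_left (hI 0) (by positivity : 0 ≤ q + 2)
  have h3 := hbase s
  have h4 := hI s
  generalize b ^ 2 * matchProb F p.ℓ (p.u₁ g) = X at *
  generalize ((wellFormed g (p.k + p.ℓ) p.v₂).card : ℝ) ^ 2 *
      (matchProb F p.ℓ (p.u₁ g) * matchProb F p.ℓ (max (p.u₁ g) (p.u₀ g))) = Y at *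
  generalize ((wellFormed g (p.k + p.ℓ) p.v₁).card : ℝ) ^ 2 *
      (matchProb F p.ℓ (p.u₀ g) * matchProb F p.ℓ (max (p.u₀ g) p.ℓ)) = V at *
  have e1 := mul_nonneg hq0 hb0
  have e2 := mul_nonneg hq0 hx0
  have e3 := mul_nonneg hq0 hN0
  have e4 := mul_nonneg hq0 hN1
  have e5 := mul_nonneg hq0 e3
  have e6 := mul_nonneg hq0 e4
  nlinarith

theorem baseSize_le_enumCost (s : Fin p.ℓ → F) :
    (p.baseSize g : ℝ) ≤ enumCost g p s := by
  rw [enumCost_eq_mean, ← mean_const (F := F) (m := p.k + p.ℓ) (ℓ := p.ℓ) (p.baseSize g : ℝ)]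
  refine mean_mono fun A => ?_
  rw [bjmm2_steps]
  have : p.baseSize g = (p.leftSet g).card := rfl
  exact_mod_cast (by omega)

/-- The level-2 vectors that the algorithm can find. -/
noncomputable abbrev Params.splitSet (p : Params) (g : F) : Finset (Fin (p.k + p.ℓ) → F) :=
  splitVectors g (p.k + p.ℓ) (p.v₂ / 2) (p.v₂ / 2)

theorem card_splitSet (hg : g ≠ 0) (hp : p.Admissible g) :
    (p.splitSet g).card = p.baseSize g ^ 2 := by
  obtain ⟨M, hM⟩ := hp.even_length
  rw [Params.baseSize, card_splitVectors hg (M := M) (by omega),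
    card_splitVectors hg (M := M) (by omega)]
  simp
  ring

theorem splitSet_subset (hp : p.Admissible g) :
    p.splitSet g ⊆ wellFormed g (p.k + p.ℓ) p.v₂ := by
  have h := splitVectors_subset g (p.k + p.ℓ) (p.v₂ / 2) (p.v₂ / 2)
  obtain ⟨w, hw⟩ := hp.even_weight
  rwa [show p.v₂ / 2 + p.v₂ / 2 = p.v₂ by omega] at h

theorem mem_listC (hp : p.Admissible g) {t : Fin p.ℓ → F} {x : Fin (p.k + p.ℓ) → F}
    (hx : x ∈ p.splitSet g) (h : Agrees A (p.u₁ g) t x) : x ∈ p.listC g A t := by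
  obtain ⟨y, hy, z, hz, rfl⟩ := exists_add_eq_of_mem_splitVectors hx
  exact mem_mergeSet.2 ⟨⟨y, hy, z, hz, h, rfl⟩, splitSet_subset hp hx⟩

/-- The list `C₀` contains every vector of equal half weights that agrees with zero, and the number
of vectors of equal half weights is the square of the base size. -/
theorem le_enumCost_listC (hg : g ≠ 0) (hp : p.Admissible g) (s : Fin p.ℓ → F) :
    (p.baseSize g : ℝ) ^ 2 * matchProb F p.ℓ (p.u₁ g) ≤ enumCost g p s := by
  have h1 : mean (fun A : Matrix (Fin (p.k + p.ℓ)) (Fin p.ℓ) F =>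
      (((p.splitSet g).filter fun x => Agrees A (p.u₁ g) 0 x).card : ℝ)) ≤ enumCost g p s := by
    rw [enumCost_eq_mean]
    refine mean_mono fun A => ?_
    have : (p.splitSet g).filter (fun x => Agrees A (p.u₁ g) 0 x) ⊆ p.listC g A 0 := fun x hx =>
      mem_listC hp (Finset.mem_filter.1 hx).1 (Finset.mem_filter.1 hx).2
    have := Finset.card_le_card this
    rw [bjmm2_steps]
    exact_mod_cast (by omega)
  refine le_trans ?_ h1
  rw [mean_card_filter, ← Nat.cast_pow, ← card_splitSet hg hp, ← nsmul_eq_mul]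
  refine Finset.card_nsmul_le_sum _ _ _ fun x _ => ?_
  -- The zero vector always agrees with the target zero, so the lower bound by `matchProb` persists.
  by_cases hx : x = 0
  · subst hx
    have : prob (fun A : Matrix (Fin (p.k + p.ℓ)) (Fin p.ℓ) F =>
        Agrees A (p.u₁ g) (0 : Fin p.ℓ → F) 0) = 1 := by
      have h0 : ∀ A : Matrix (Fin (p.k + p.ℓ)) (Fin p.ℓ) F,
          Agrees A (p.u₁ g) (0 : Fin p.ℓ → F) 0 := fun A j _ => by rw [Matrix.zero_vecMul]
      simp only [prob, if_pos (h0 _)]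
      exact mean_const 1
    rw [this]
    exact matchProb_le_one _ _
  · rw [prob_agrees_of_ne_zero hx]

/-- If `x` agrees with zero on `u₁` positions and `x + y` on `max u₁ u₀`, then `y` also agrees with
zero on `u₁` positions, so both lie in `C₀` and collide. -/
theorem le_enumCost_middleCollisions (hg : g ≠ 0) (hp : p.Admissible g) (s : Fin p.ℓ → F) :
    (p.baseSize g : ℝ) ^ 2 * ((p.baseSize g : ℝ) ^ 2 - Fintype.card F) *
      (matchProb F p.ℓ (p.u₁ g) * matchProb F p.ℓ (max (p.u₁ g) (p.u₀ g))) ≤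
    enumCost g p s := by
  have h1 : mean (fun A : Matrix (Fin (p.k + p.ℓ)) (Fin p.ℓ) F =>
      (((independentPairs (p.splitSet g)).filter fun x => Agrees A (p.u₁ g) 0 x.1 ∧
        Agrees A (max (p.u₁ g) (p.u₀ g)) 0 (x.1 + x.2)).card : ℝ)) ≤ enumCost g p s := by
    rw [enumCost_eq_mean]
    refine mean_mono fun A => ?_
    have : (independentPairs (p.splitSet g)).filter (fun x => Agrees A (p.u₁ g) 0 x.1 ∧
        Agrees A (max (p.u₁ g) (p.u₀ g)) 0 (x.1 + x.2)) ⊆ p.middleCollisions g A 0 := by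
      intro x hx
      rw [Finset.mem_filter, mem_independentPairs] at hx
      obtain ⟨⟨⟨h1, h2⟩, -⟩, h3, h4⟩ := hx
      have h5 : Agrees A (p.u₁ g) 0 x.2 := by
        simpa using (h4.mono (le_max_left _ _)).sub h3
      exact Finset.mem_filter.2 ⟨Finset.mem_product.2 ⟨mem_listC hp h1 h3, mem_listC hp h2 h5⟩,
        h4.mono (le_max_right _ _)⟩
    have := Finset.card_le_card this
    rw [bjmm2_steps]
    exact_mod_cast (by omega)
  refine le_trans ?_ h1
  rw [mean_card_filter, Finset.sum_congr rfl fun x hx =>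
    prob_independentPair (splitSet_subset hp) hx _ _ _, Finset.sum_const, nsmul_eq_mul]
  have h2 := matchProb_pos (F := F) p.ℓ (p.u₁ g)
  have h3 := matchProb_pos (F := F) p.ℓ (max (p.u₁ g) (p.u₀ g))
  gcongr
  have h4 := card_independentPairs_ge (p.splitSet g)
  rw [card_splitSet hg hp] at h4
  exact_mod_cast h4

/-- Numbers that describe how a level-1 vector and its representations split into halves. -/
structure Params.Split (p : Params) (a b e₁ e₂ : ℕ) : Prop where
  weight : a + b = p.v₁
  overlap : e₁ + e₂ = p.ε₂
  left : 2 * (p.v₂ / 2) = a + 2 * e₁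
  right : 2 * (p.v₂ / 2) = b + 2 * e₂

/-- A single surviving representation suffices: if `x` agrees with zero and `y` with `t` on `u₁`
positions, then `y - x` agrees with `t` there, so the two summands lie in the two level-2 lists. -/
theorem mem_listD (hg : g ≠ 0) (hp : p.Admissible g) {a b e₁ e₂ : ℕ} (hs : p.Split a b e₁ e₂)
    {t : Fin p.ℓ → F} {x y : Fin (p.k + p.ℓ) → F}
    (hy : y ∈ splitVectors g (p.k + p.ℓ) a b) (hx : x ∈ splitRepresentations g y a b e₁ e₂)
    (hyA : Agrees A (max (p.u₀ g) (p.u₁ g)) t y) (hxA : Agrees A (p.u₁ g) 0 x) :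
    y ∈ p.listD g A t := by
  have hc : -1 ∈ errorSet g ∨ e₁ = 0 ∧ e₂ = 0 := hp.cancel.imp id fun h => by
    have := hs.overlap
    omega
  obtain ⟨h1, h2⟩ := mem_splitVectors_of_mem_splitRepresentations hg hc
    (by have := hs.left; omega) (by have := hs.right; omega) hy hx
  have h3 : Agrees A (p.u₁ g) t (y - x) := by
    simpa using (hyA.mono (le_max_right _ _)).sub hxA
  refine mem_mergeSet.2 ⟨⟨x, mem_listC hp h1 hxA, y - x, mem_listC hp h2 h3, ?_, ?_⟩, ?_⟩
  · rw [add_sub_cancel]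
    exact hyA.mono (le_max_left _ _)
  · rw [add_sub_cancel]
  · rw [← hs.weight]
    exact splitVectors_subset _ _ _ _ hy

/-- Independent pairs `(y₁, y₂)` are counted for which `y₁` and `y₁ + y₂` have the right images and
both vectors have a surviving representation. The bound for a pair of representations is applied
with `d = 2`, whence the powers `q ^ 3` and `q ^ 5`. -/
theorem le_enumCost_finalCollisions (hg : g ≠ 0) (hp : p.Admissible g) (s : Fin p.ℓ → F)
    {a b e₁ e₂ N r : ℕ} (hs : p.Split a b e₁ e₂)
    (hN : (splitVectors g (p.k + p.ℓ) a b).card = N)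
    (hr : numSplitRepresentations (orderOf g) ((p.k + p.ℓ) / 2) a b e₁ e₂ = r)
    (hrq : 2 * (Fintype.card F : ℝ) ^ 3 ≤ r) :
    (N : ℝ) * (N - Fintype.card F) *
      (matchProb F p.ℓ (max (p.u₀ g) (p.u₁ g)) * matchProb F p.ℓ p.ℓ *
        ((r * matchProb F p.ℓ (p.u₁ g)) ^ 2 / 4 /
        (r * matchProb F p.ℓ (p.u₁ g) + (Fintype.card F : ℝ) ^ 5) ^ 2)) ≤
    enumCost g p s := by
  classical
  set B := splitVectors g (p.k + p.ℓ) a b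
  have hB : B ⊆ wellFormed g (p.k + p.ℓ) p.v₁ := hs.weight ▸ splitVectors_subset _ _ _ _
  set w := max (p.u₀ g) (p.u₁ g)
  let E : (Fin (p.k + p.ℓ) → F) × (Fin (p.k + p.ℓ) → F) →
      Matrix (Fin (p.k + p.ℓ)) (Fin p.ℓ) F → Prop := fun y A =>
    ∃ x ∈ splitRepresentations g y.1 a b e₁ e₂, ∃ x' ∈ splitRepresentations g y.2 a b e₁ e₂,
      Agrees A (p.u₁ g) 0 x' ∧ Agrees A (p.u₁ g) 0 x ∧
      AllAgree A (Fin.cons p.ℓ ![w]) (Fin.cons s ![0]) (Fin.cons (y.1 + y.2) ![y.1])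
  have h1 : mean (fun A : Matrix (Fin (p.k + p.ℓ)) (Fin p.ℓ) F =>
      (((independentPairs B).filter fun y => E y A).card : ℝ)) ≤ enumCost g p s := by
    rw [enumCost_eq_mean]
    refine mean_mono fun A => ?_
    have : (independentPairs B).filter (fun y => E y A) ⊆ p.finalCollisions g A s := by
      intro y hy
      rw [Finset.mem_filter, mem_independentPairs] at hy
      obtain ⟨⟨⟨h1, h2⟩, -⟩, x, hx, x', hx', hx'A, hxA, hyA⟩ := hy
      rw [allAgree_cons] at hyA
      have h3 : Agrees A w 0 y.1 := by simpa [AllAgree] using hyA.2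
      -- The target of `y₂` is not imposed separately: it follows by subtraction from those of `y₁ +
      -- y₂` and `y₁`.
      have h4 : Agrees A w s y.2 := by simpa using hyA.1.of_length_le.sub h3
      exact Finset.mem_filter.2 ⟨Finset.mem_product.2 ⟨mem_listD hg hp hs h1 hx h3 hxA,
        mem_listD hg hp hs h2 hx' h4 hx'A⟩, hyA.1⟩
    have := Finset.card_le_card this
    rw [bjmm2_steps]
    exact_mod_cast (by omega)
  refine le_trans ?_ h1
  rw [mean_card_filter]
  have h2 : ∀ y ∈ independentPairs B, matchProb F p.ℓ w * matchProb F p.ℓ p.ℓ *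
        ((r * matchProb F p.ℓ (p.u₁ g)) ^ 2 / 4 /
        (r * matchProb F p.ℓ (p.u₁ g) + (Fintype.card F : ℝ) ^ 5) ^ 2) ≤ prob (E y) := by
    intro y hy
    have hne := fst_ne_zero_of_mem_independentPairs hB hy
    rw [mem_independentPairs] at hy
    have hind : LinearIndependent F
        (Fin.cons (y.1 + y.2) ![y.1] : Fin 2 → Fin (p.k + p.ℓ) → F) :=
      linearIndependent_finCons.2
        ⟨linearIndependent_singleton_vec hne, add_notMem_span hy.2⟩
    obtain ⟨M, hM⟩ := hp.even_length
    have hM2 : (p.k + p.ℓ) / 2 = M := by omega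
    rw [hM2] at hr
    have h := prob_exists_pair_ge hind (Fin.cons p.ℓ ![w]) (Fin.cons s ![0]) (p.u₁ g) r
      ((card_splitRepresentations hg (by omega) e₁ e₂ hy.1.1).trans hr)
      ((card_splitRepresentations hg (by omega) e₁ e₂ hy.1.2).trans hr) hrq
    rw [prob_allAgree hind] at h
    rw [Fin.prod_univ_succ, Fin.prod_univ_one] at h
    simp only [Fin.cons_zero, Fin.cons_succ, Matrix.cons_val_fin_one] at h
    refine le_trans (le_of_eq ?_) (h.trans (le_of_eq (prob_congr fun A => Iff.rfl)))
    congr 1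
    exact mul_comm _ _
  refine le_trans ?_ (Finset.card_nsmul_le_sum _ _ _ h2)
  rw [nsmul_eq_mul]
  have h3 := matchProb_pos (F := F) p.ℓ (p.u₁ g)
  have h4 := matchProb_pos (F := F) p.ℓ w
  have h5 := matchProb_pos (F := F) p.ℓ p.ℓ
  gcongr
  have h6 := card_independentPairs_ge B
  rwa [hN] at h6

end Cost


/-! ### Asymptotics of the parameters -/

theorem tendsto_div_of_abs_sub_le {c x : ℕ → ℝ} {α K : ℝ}
    (hx : Tendsto (fun n : ℕ => x n / n) atTop (𝓝 α)) (h : ∀ n, |c n - x n| ≤ K) :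
    Tendsto (fun n : ℕ => c n / n) atTop (𝓝 α) := by
  have h1 : Tendsto (fun n : ℕ => (c n - x n) / n) atTop (𝓝 0) := by
    refine squeeze_zero_norm (a := fun n : ℕ => K / n) (fun n => ?_)
      (tendsto_const_nhds.div_atTop tendsto_natCast_atTop_atTop)
    rw [Real.norm_eq_abs, abs_div, Nat.abs_cast]
    gcongr
    exact h n
  simpa [← add_div] using h1.add hx

theorem tendsto_mul_div (α : ℝ) : Tendsto (fun n : ℕ => (n * α) / (n : ℝ)) atTop (𝓝 α) := by
  refine tendsto_const_nhds.congr' ?_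
  filter_upwards [eventually_gt_atTop 0] with n hn
  field_simp

theorem tendsto_half {a c : ℕ → ℕ} {α : ℝ}
    (ha : Tendsto (fun n => (a n : ℝ) / n) atTop (𝓝 α))
    (h : ∀ n, 2 * c n ≤ a n + 2 ∧ a n ≤ 2 * c n + 2) :
    Tendsto (fun n => (c n : ℝ) / n) atTop (𝓝 (α / 2)) := by
  refine tendsto_div_of_abs_sub_le (x := fun n => (a n : ℝ) / 2) (K := 1)
    ((ha.div_const 2).congr fun n => by ring) fun n => ?_
  have h1 : (2 * c n : ℝ) ≤ a n + 2 := by exact_mod_cast (h n).1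
  have h2 : (a n : ℝ) ≤ 2 * c n + 2 := by exact_mod_cast (h n).2
  rw [abs_le]
  constructor <;> linarith

/-- Admissible parameters with given rates exist. -/
theorem exists_params {F : Type*} [Field F] [DecidableEq F] (g : F) {R L V₀ V₁ V₂ E₁ E₂ : ℝ}
    (hR : 0 ≤ R) (hL : 0 ≤ L) (hV₀ : 0 ≤ V₀) (hE₁ : 0 ≤ E₁) (hE₂ : 0 ≤ E₂)
    (hV₁ : V₁ = V₀ / 2 + E₁) (hV₂ : V₂ = V₁ / 2 + E₂)
    (hroom₁ : V₀ + E₁ ≤ R + L) (hroom₂ : V₁ + E₂ ≤ R + L)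
    (hcancel : -1 ∈ errorSet g ∨ (E₁ = 0 ∧ E₂ = 0)) :
    ∃ p : ℕ → Params, (∀ n, (p n).Admissible g) ∧ HasRates p R L V₀ V₁ V₂ E₁ E₂ := by
  -- The weights are built from multiples of 8, 4 and 2, so that two halvings and the parity
  -- conditions are exact. Weights and overlaps are rounded down and lengths up, so that the room
  -- conditions survive the rounding.
  let x : ℕ → ℕ := fun n => ⌊n * V₀ / 8⌋₊
  let y : ℕ → ℕ := fun n => ⌊n * E₁ / 4⌋₊
  let w : ℕ → ℕ := fun n => ⌊n * E₂ / 2⌋₊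
  let c : ℕ → ℕ := fun n => ⌈n * R / 2⌉₊
  let d : ℕ → ℕ := fun n => ⌈n * L / 2⌉₊
  have hn : ∀ n : ℕ, (0 : ℝ) ≤ n := fun n => Nat.cast_nonneg n
  have hx : ∀ n : ℕ, (x n : ℝ) ≤ n * V₀ / 8 ∧ n * V₀ / 8 < x n + 1 := fun n =>
    ⟨Nat.floor_le (by have := hn n; positivity), Nat.lt_floor_add_one _⟩
  have hy : ∀ n : ℕ, (y n : ℝ) ≤ n * E₁ / 4 ∧ n * E₁ / 4 < y n + 1 := fun n =>
    ⟨Nat.floor_le (by have := hn n; positivity), Nat.lt_floor_add_one _⟩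
  have hw : ∀ n : ℕ, (w n : ℝ) ≤ n * E₂ / 2 ∧ n * E₂ / 2 < w n + 1 := fun n =>
    ⟨Nat.floor_le (by have := hn n; positivity), Nat.lt_floor_add_one _⟩
  have hc : ∀ n : ℕ, n * R / 2 ≤ (c n : ℝ) ∧ (c n : ℝ) < n * R / 2 + 1 := fun n =>
    ⟨Nat.le_ceil _, Nat.ceil_lt_add_one (by have := hn n; positivity)⟩
  have hd : ∀ n : ℕ, n * L / 2 ≤ (d n : ℝ) ∧ (d n : ℝ) < n * L / 2 + 1 := fun n =>
    ⟨Nat.le_ceil _, Nat.ceil_lt_add_one (by have := hn n; positivity)⟩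
  refine ⟨fun n => ⟨2 * c n, 2 * d n, 8 * x n, 4 * x n + 4 * y n, 2 * x n + 2 * y n + 2 * w n,
    4 * y n, 2 * w n⟩, fun n => ⟨?_, ?_, ?_, ?_, ?_, ?_, ?_⟩, ⟨?_, ?_, ?_, ?_, ?_, ?_, ?_⟩⟩
  · dsimp only
    ring
  · dsimp only
    ring
  · dsimp only
    have h1 := mul_le_mul_of_nonneg_left hroom₁ (hn n)
    have h2 : ((8 * x n + 4 * y n : ℕ) : ℝ) ≤ ((2 * c n + 2 * d n : ℕ) : ℝ) := by
      push_cast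
      linarith [hx n, hy n, hc n, hd n]
    exact_mod_cast h2
  · dsimp only
    have h1 := mul_le_mul_of_nonneg_left hroom₂ (hn n)
    have h2 : ((4 * x n + 4 * y n + 2 * w n : ℕ) : ℝ) ≤ ((2 * c n + 2 * d n : ℕ) : ℝ) := by
      push_cast
      rw [hV₁] at h1
      linarith [hx n, hy n, hc n, hd n, hw n]
    exact_mod_cast h2
  · dsimp only
    exact ⟨c n + d n, by ring⟩
  · dsimp only
    exact ⟨x n + y n + w n, by ring⟩
  · refine hcancel.imp id ?_
    rintro ⟨rfl, rfl⟩
    simp [y, w]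
  · refine tendsto_div_of_abs_sub_le (K := 2) (tendsto_mul_div R) fun n => ?_
    rw [abs_le]
    push_cast
    constructor <;> linarith [hc n]
  · refine tendsto_div_of_abs_sub_le (K := 2) (tendsto_mul_div L) fun n => ?_
    rw [abs_le]
    push_cast
    constructor <;> linarith [hd n]
  · refine tendsto_div_of_abs_sub_le (K := 8) (tendsto_mul_div V₀) fun n => ?_
    rw [abs_le]
    push_cast
    constructor <;> linarith [hx n]
  · refine tendsto_div_of_abs_sub_le (K := 8) (tendsto_mul_div V₁) fun n => ?_
    rw [abs_le, hV₁]
    push_cast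
    constructor <;> linarith [hx n, hy n]
  · refine tendsto_div_of_abs_sub_le (K := 8) (tendsto_mul_div V₂) fun n => ?_
    rw [abs_le, hV₂, hV₁]
    push_cast
    constructor <;> linarith [hx n, hy n, hw n]
  · refine tendsto_div_of_abs_sub_le (K := 4) (tendsto_mul_div E₁) fun n => ?_
    rw [abs_le]
    push_cast
    constructor <;> linarith [hy n]
  · refine tendsto_div_of_abs_sub_le (K := 2) (tendsto_mul_div E₂) fun n => ?_
    rw [abs_le]
    push_cast
    constructor <;> linarith [hw n]

/-! ### Growth rates of representation numbers, match probabilities and lists -/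

theorem h_two_inv : h 2⁻¹ = 1 := by
  rw [h, Real.binEntropy_two_inv, div_self (Real.log_pos one_lt_two).ne']

theorem mul_h_half (V : ℝ) : V * h (V / 2 / V) = V := by
  rcases eq_or_ne V 0 with rfl | hV
  · simp
  · rw [show V / 2 / V = 2⁻¹ by field_simp, h_two_inv, mul_one]

theorem h_nonneg {x : ℝ} (h0 : 0 ≤ x) (h1 : x ≤ 1) : 0 ≤ h x :=
  div_nonneg (Real.binEntropy_nonneg h0 h1) (Real.log_pos one_lt_two).le

/-- Besides showing that the exponents `U` are non-negative, this makes `U₁` positive as soon as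
`V₁` is. -/
theorem le_repExponent {Z M V E : ℝ} (hZ : 0 ≤ Z) (hE : 0 ≤ E) (hM : V + E ≤ M) :
    V ≤ repExponent Z M V E := by
  have h1 : 0 ≤ (M - V) * h (E / (M - V)) :=
    mul_nonneg (by linarith)
      (h_nonneg (div_nonneg hE (by linarith)) (div_le_one_of_le₀ (by linarith) (by linarith)))
  have h2 : 0 ≤ Z * E := mul_nonneg hZ hE
  unfold repExponent
  linarith

/-- The number of ways to choose a weighted support together with its entries. -/
theorem growthRate_choose_mul_pow {z : ℕ} (hz : 0 < z) {a b : ℕ → ℕ} {α β : ℝ}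
    (hab : ∀ n, b n ≤ a n) (ha : Tendsto (fun n => (a n : ℝ) / n) atTop (𝓝 α))
    (hb : Tendsto (fun n => (b n : ℝ) / n) atTop (𝓝 β)) :
    GrowthRate (fun n => (((a n).choose (b n) * z ^ b n : ℕ) : ℝ))
      (sizeExponent (Real.logb 2 z) α β) := by
  push_cast
  exact (growthRate_choose hab ha hb).mul (growthRate_pow hz hb)

theorem sizeExponent_half (Z M V : ℝ) :
    sizeExponent Z (M / 2) (V / 2) = sizeExponent Z M V / 2 := by
  rw [sizeExponent, sizeExponent, div_div_div_cancel_right₀ two_ne_zero]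
  ring

/-- The number of ways to represent a vector. -/
theorem growthRate_representations {z : ℕ} (hz : 0 < z) {m v c ε : ℕ → ℕ} {M V E : ℝ}
    (hroom : ∀ n, v n + ε n ≤ m n) (hc : ∀ n, c n = v n / 2)
    (hm : Tendsto (fun n => (m n : ℝ) / n) atTop (𝓝 M))
    (hv : Tendsto (fun n => (v n : ℝ) / n) atTop (𝓝 V))
    (hε : Tendsto (fun n => (ε n : ℝ) / n) atTop (𝓝 E)) :
    GrowthRate (fun n => (((v n).choose (c n) * ((m n - v n).choose (ε n) * z ^ ε n) : ℕ) : ℝ))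
      (repExponent (Real.logb 2 z) M V E) := by
  have h1 : Tendsto (fun n => (c n : ℝ) / n) atTop (𝓝 (V / 2)) :=
    tendsto_half hv fun n => by have := hc n; omega
  have h2 : Tendsto (fun n => ((m n - v n : ℕ) : ℝ) / n) atTop (𝓝 (M - V)) := by
    refine (hm.sub hv).congr fun n => ?_
    rw [Nat.cast_sub ((Nat.le_add_right _ _).trans (hroom n)), sub_div]
  have h3 := growthRate_choose (fun n => by have := hc n; omega) hv h1
  have h4 := growthRate_choose_mul_pow hz (fun n => by have := hroom n; omega) h2 hε
  have h5 := h3.mul h4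
  rw [mul_h_half, sizeExponent, ← add_assoc] at h5
  refine h5.of_eventuallyEq (Eventually.of_forall fun n => ?_)
  push_cast
  rfl

theorem growthRate_pow_log {q : ℕ} (hq : 1 < q) {r : ℕ → ℕ} {U : ℝ} (hr0 : ∀ n, r n ≠ 0)
    (hr : GrowthRate (fun n => (r n : ℝ)) U) :
    GrowthRate (fun n => (q : ℝ) ^ Nat.log q (r n)) U := by
  have hq' : (0 : ℝ) < q := by exact_mod_cast (by omega : 0 < q)
  refine (hr.const_mul (inv_pos.2 hq')).squeeze hr (Eventually.of_forall fun n => ?_)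
    (Eventually.of_forall fun n => ?_)
  · rw [inv_mul_le_iff₀ hq', ← pow_succ']
    exact_mod_cast (Nat.lt_pow_succ_log_self hq (r n)).le
  · exact_mod_cast Nat.pow_log_le_self q (hr0 n)

theorem GrowthRate.tendsto_logb_mul {q : ℝ} {u : ℕ → ℕ} {U : ℝ}
    (hu : GrowthRate (fun n => q ^ u n) U) :
    Tendsto (fun n : ℕ => Real.logb 2 q * ((u n : ℝ) / n)) atTop (𝓝 U) := by
  refine hu.2.congr fun n => ?_
  rw [Real.logb_pow]
  ring

theorem GrowthRate.pow_max {q : ℝ} (hq : 1 ≤ q) {u u' : ℕ → ℕ} {U U' : ℝ}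
    (hu : GrowthRate (fun n => q ^ u n) U) (hu' : GrowthRate (fun n => q ^ u' n) U') :
    GrowthRate (fun n => q ^ Max.max (u n) (u' n)) (Max.max U U') :=
  (hu.max hu').of_eventuallyEq
    (Eventually.of_forall fun _ => ((pow_right_mono₀ hq).map_max).symm)

/-- For single `n` the number of positions `u` may exceed `ℓ`; the inverse of `q ^ min u ℓ` is the
larger of the two inverse powers, so only the inequality of the exponents matters. -/
theorem growthRate_matchProb {F : Type*} [Field F] [Fintype F] {u ℓ : ℕ → ℕ} {U L : ℝ}
    (hu : GrowthRate (fun n => (Fintype.card F : ℝ) ^ u n) U)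
    (hℓ : GrowthRate (fun n => (Fintype.card F : ℝ) ^ ℓ n) L) (hU : U ≤ L) :
    GrowthRate (fun n => matchProb F (ℓ n) (u n)) (-U) := by
  have hq : (1 : ℝ) < Fintype.card F := by exact_mod_cast Fintype.one_lt_card
  have h1 := hu.inv.max hℓ.inv
  rw [max_eq_left (neg_le_neg hU)] at h1
  refine h1.of_eventuallyEq (Eventually.of_forall fun n => ?_)
  have hq0 : (0 : ℝ) < Fintype.card F := by linarith
  rw [matchProb]
  rcases le_total (u n) (ℓ n) with h | h
  · rw [min_eq_left h, max_eq_left]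
    gcongr
    exact hq.le
  · rw [min_eq_right h, max_eq_right]
    gcongr
    exact hq.le

/-- Since `v₂ = v₁ / 2 + ε₂` is even, `v₁ / 2` and `ε₂` have the same parity. If both are even,
everything is halved; if both are odd, moving one unit of weight to the left half is offset by one
more overlap on the right. -/
theorem Params.exists_split {F : Type*} [Field F] [DecidableEq F] {g : F} {p : Params}
    (hp : p.Admissible g) :
    ∃ a b e₁ e₂, p.Split a b e₁ e₂ ∧ (a + e₁ ≤ (p.k + p.ℓ) / 2 ∧ b + e₂ ≤ (p.k + p.ℓ) / 2) ∧
      (2 * a ≤ p.v₁ + 2 ∧ p.v₁ ≤ 2 * a + 2) ∧ (2 * b ≤ p.v₁ + 2 ∧ p.v₁ ≤ 2 * b + 2) ∧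
      (2 * e₁ ≤ p.ε₂ + 2 ∧ p.ε₂ ≤ 2 * e₁ + 2) ∧ (2 * e₂ ≤ p.ε₂ + 2 ∧ p.ε₂ ≤ 2 * e₂ + 2) := by
  obtain ⟨M, hM⟩ := hp.even_length
  obtain ⟨w, hw⟩ := hp.even_weight
  have h1 := hp.weight₂
  have h2 := hp.room₂
  rcases Nat.even_or_odd' (p.v₁ / 2) with ⟨c, hc | hc⟩
  · refine ⟨p.v₁ / 2, p.v₁ / 2, p.ε₂ / 2, p.ε₂ / 2, ⟨?_, ?_, ?_, ?_⟩, ?_, ?_, ?_, ?_, ?_⟩ <;>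
      omega
  · refine ⟨p.v₁ / 2 + 1, p.v₁ / 2 - 1, p.ε₂ / 2, p.ε₂ / 2 + 1,
      ⟨?_, ?_, ?_, ?_⟩, ?_, ?_, ?_, ?_, ?_⟩ <;> omega


theorem repExponent_half (Z M V E : ℝ) :
    repExponent Z (M / 2) (V / 2) (E / 2) = repExponent Z M V E / 2 := by
  rw [repExponent, repExponent, ← sub_div, div_div_div_cancel_right₀ two_ne_zero]
  ring

section Rates

variable {F : Type*} [Field F] [Fintype F] [DecidableEq F] {g : F} {p : ℕ → Params}
  {R L V₀ V₁ V₂ E₁ E₂ : ℝ}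

theorem HasRates.length (hr : HasRates p R L V₀ V₁ V₂ E₁ E₂) :
    Tendsto (fun n => (((p n).k + (p n).ℓ : ℕ) : ℝ) / n) atTop (𝓝 (R + L)) := by
  refine (hr.k.add hr.ℓ).congr fun n => ?_
  push_cast
  ring

theorem HasRates.halfLength (hr : HasRates p R L V₀ V₁ V₂ E₁ E₂) :
    Tendsto (fun n => ((((p n).k + (p n).ℓ) / 2 : ℕ) : ℝ) / n) atTop (𝓝 ((R + L) / 2)) :=
  tendsto_half hr.length fun n => by omega

theorem growthRate_wellFormed (hg : g ≠ 0) {m v : ℕ → ℕ} {M V : ℝ} (hvm : ∀ n, v n ≤ m n)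
    (hm : Tendsto (fun n => (m n : ℝ) / n) atTop (𝓝 M))
    (hv : Tendsto (fun n => (v n : ℝ) / n) atTop (𝓝 V)) :
    GrowthRate (fun n => ((wellFormed g (m n) (v n)).card : ℝ))
      (sizeExponent (Real.logb 2 (orderOf g)) M V) := by
  refine (growthRate_choose_mul_pow (orderOf_pos_of_ne_zero hg) hvm hm hv).of_eventuallyEq
    (Eventually.of_forall fun n => ?_)
  rw [card_wellFormed hg]

/-- The growth rate of `q ^ u` for the number `u` of positions of a merge. -/
theorem growthRate_pow_numRepresentations (hg : g ≠ 0) {m v w ε : ℕ → ℕ} {M V E : ℝ}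
    (hw : ∀ n, 2 * w n = v n + 2 * ε n) (hroom : ∀ n, v n + ε n ≤ m n)
    (hcancel : ∀ n, -1 ∈ errorSet g ∨ ε n = 0)
    (hm : Tendsto (fun n => (m n : ℝ) / n) atTop (𝓝 M))
    (hv : Tendsto (fun n => (v n : ℝ) / n) atTop (𝓝 V))
    (hε : Tendsto (fun n => (ε n : ℝ) / n) atTop (𝓝 E)) :
    GrowthRate (fun n => (Fintype.card F : ℝ) ^
      Nat.log (Fintype.card F) (numRepresentations g (m n) (v n) (w n)))
      (repExponent (Real.logb 2 (orderOf g)) M V E) := by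
  have hz := orderOf_pos_of_ne_zero hg
  have hv2 : ∀ n, v n ≤ m n := fun n => (Nat.le_add_right _ _).trans (hroom n)
  have heq : ∀ n, numRepresentations g (m n) (v n) (w n) =
      (v n).choose (v n / 2) * ((m n - v n).choose (ε n) * orderOf g ^ ε n) := fun n =>
    numRepresentations_eq hg (hw n) (hv2 n) (hcancel n)
  refine growthRate_pow_log Fintype.one_lt_card (fun n => ?_) ?_
  · rw [heq]
    have h1 := Nat.choose_pos (Nat.div_le_self (v n) 2)
    have h2 := Nat.choose_pos (show ε n ≤ m n - v n by have := hroom n; omega)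
    positivity
  · refine (growthRate_representations hz hroom (fun _ => rfl) hm hv hε).of_eventuallyEq
      (Eventually.of_forall fun n => ?_)
    rw [heq]

variable (hg : g ≠ 0) (hp : ∀ n, (p n).Admissible g) (hr : HasRates p R L V₀ V₁ V₂ E₁ E₂)

include hg hp hr

theorem growthRate_pow_u₀ : GrowthRate (fun n => (Fintype.card F : ℝ) ^ (p n).u₀ g)
    (repExponent (Real.logb 2 (orderOf g)) (R + L) V₀ E₁) :=
  growthRate_pow_numRepresentations hg (fun n => (hp n).weight₁) (fun n => (hp n).room₁)
    (fun n => (hp n).cancel.imp id And.left) hr.length hr.v₀ hr.ε₁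

theorem growthRate_pow_u₁ : GrowthRate (fun n => (Fintype.card F : ℝ) ^ (p n).u₁ g)
    (repExponent (Real.logb 2 (orderOf g)) (R + L) V₁ E₂) :=
  growthRate_pow_numRepresentations hg (fun n => (hp n).weight₂) (fun n => (hp n).room₂)
    (fun n => (hp n).cancel.imp id And.right) hr.length hr.v₁ hr.ε₂

theorem growthRate_baseSize : GrowthRate (fun n => ((p n).baseSize g : ℝ))
    (sizeExponent (Real.logb 2 (orderOf g)) (R + L) V₂ / 2) := by
  have h1 : Tendsto (fun n => (((p n).v₂ / 2 : ℕ) : ℝ) / n) atTop (𝓝 (V₂ / 2)) :=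
    tendsto_half hr.v₂ fun n => by omega
  have h2 := growthRate_choose_mul_pow (orderOf_pos_of_ne_zero hg)
    (fun n => by have := (hp n).room₂; have := (hp n).weight₂; omega) hr.halfLength h1
  rw [sizeExponent_half] at h2
  refine h2.of_eventuallyEq (Eventually.of_forall fun n => ?_)
  obtain ⟨M, hM⟩ := (hp n).even_length
  rw [Params.baseSize, card_splitVectors hg (M := M) (by omega),
    show ((p n).k + (p n).ℓ) / 2 = M by omega]
  simp

theorem one_le_enumCost (n : ℕ) (s : Fin (p n).ℓ → F) : 1 ≤ enumCost g (p n) s := by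
  refine le_trans ?_ (baseSize_le_enumCost s)
  obtain ⟨M, hM⟩ := (hp n).even_length
  rw [Params.baseSize, card_splitVectors hg (M := M) (by omega)]
  have h1 := Nat.choose_pos (show (p n).v₂ / 2 ≤ M by
    have := (hp n).room₂; have := (hp n).weight₂; omega)
  have h2 := orderOf_pos_of_ne_zero hg
  have h3 : 0 < M.choose ((p n).v₂ / 2) * orderOf g ^ ((p n).v₂ / 2) *
    (M.choose 0 * orderOf g ^ 0) := by
    rw [Nat.choose_zero_right]
    positivity
  exact_mod_cast h3

end Rates

/-! ### Matching exponential bounds and the main theorem -/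

section Main

variable {F : Type*} [Field F] [Fintype F] [DecidableEq F] {g : F} {p : ℕ → Params}
  {R L V₀ V₁ V₂ E₁ E₂ S₁ S₂ U₀ U₁ C : ℝ}

theorem GrowthRate.eventually_le_half_sub {f : ℕ → ℝ} {α : ℝ} (hf : GrowthRate f α) (hα : 0 < α)
    (c : ℝ) : ∀ᶠ n in atTop, 2⁻¹ * f n ≤ f n - c := by
  filter_upwards [(hf.tendsto_atTop hα).eventually_ge_atTop (2 * c)] with n hn
  linarith

/-- A lower bound of the cost by a sequence with a non-positive exponent is trivial. -/
theorem exists_growthRate_le_of_nonpos (hg : g ≠ 0) (hp : ∀ n, (p n).Admissible g)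
    (hr : HasRates p R L V₀ V₁ V₂ E₁ E₂) (s : (n : ℕ) → Fin (p n).ℓ → F) (hC : C ≤ 0) :
    ∃ T : ℕ → ℝ, GrowthRate T C ∧ ∀ᶠ n in atTop, T n ≤ enumCost g (p n) (s n) :=
  ⟨_, GrowthRate.two_rpow C, Eventually.of_forall fun n =>
    (Real.rpow_le_one_of_one_le_of_nonpos one_le_two
      (mul_nonpos_of_nonneg_of_nonpos (Nat.cast_nonneg n) hC)).trans
        (one_le_enumCost hg hp hr n (s n))⟩

/-- A positive exponent forces `S₂ > 0`; then the squared base size tends to infinity and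
subtracting `q` costs at most a factor 2. Otherwise the trivial bound `1` suffices. -/
theorem exists_growthRate_le_middle (hg : g ≠ 0) (hp : ∀ n, (p n).Admissible g)
    (hr : HasRates p R L V₀ V₁ V₂ E₁ E₂) (s : (n : ℕ) → Fin (p n).ℓ → F)
    (hS₂ : S₂ = sizeExponent (Real.logb 2 (orderOf g)) (R + L) V₂)
    (hU₀ : 0 ≤ U₀) (hU₁ : 0 ≤ U₁)
    (hψ₁ : GrowthRate (fun n => matchProb F (p n).ℓ ((p n).u₁ g)) (-U₁))
    (hψ : GrowthRate (fun n => matchProb F (p n).ℓ (max ((p n).u₁ g) ((p n).u₀ g))) (-U₀)) :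
    ∃ T : ℕ → ℝ, GrowthRate T (2 * S₂ - U₁ - U₀) ∧
      ∀ᶠ n in atTop, T n ≤ enumCost g (p n) (s n) := by
  rcases le_or_gt (2 * S₂ - U₁ - U₀) 0 with hC | hC
  · exact exists_growthRate_le_of_nonpos hg hp hr s hC
  have hb := growthRate_baseSize hg hp hr
  rw [← hS₂] at hb
  have hb2 : GrowthRate (fun n => ((p n).baseSize g : ℝ) ^ 2) S₂ := by
    simpa only [pow_two, add_halves] using hb.mul hb
  refine ⟨_, (hb2.mul (hb2.const_mul (inv_pos.2 two_pos))).mul (hψ₁.mul hψ) |> fun h =>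
    (show S₂ + S₂ + (-U₁ + -U₀) = 2 * S₂ - U₁ - U₀ by ring) ▸ h, ?_⟩
  filter_upwards [hb2.eventually_le_half_sub (by linarith) (Fintype.card F)] with n hn
  refine le_trans ?_ (le_enumCost_middleCollisions hg (hp n) (s n))
  have h1 := matchProb_pos (F := F) (p n).ℓ ((p n).u₁ g)
  have h2 := matchProb_pos (F := F) (p n).ℓ (max ((p n).u₁ g) ((p n).u₀ g))
  gcongr

/-- The counts for the two halves multiply to the exponents `S₁` and `U₁` of the unsplit problem, so
restricting to a fixed split costs nothing on the exponential scale. -/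
theorem exists_growthRate_le_final (hg : g ≠ 0) (hp : ∀ n, (p n).Admissible g)
    (hr : HasRates p R L V₀ V₁ V₂ E₁ E₂) (s : (n : ℕ) → Fin (p n).ℓ → F) {K : ℝ}
    (hS₁ : S₁ = sizeExponent (Real.logb 2 (orderOf g)) (R + L) V₁)
    (hU₁ : U₁ = repExponent (Real.logb 2 (orderOf g)) (R + L) V₁ E₂)
    (hV₁U : V₁ ≤ U₁) (hV₁ : 0 ≤ V₁) (hU₀ : 0 ≤ U₀) (hK : 0 ≤ K)
    (hψ₁ : GrowthRate (fun n => matchProb F (p n).ℓ ((p n).u₁ g)) (-U₁))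
    (hψ : GrowthRate (fun n => matchProb F (p n).ℓ (max ((p n).u₀ g) ((p n).u₁ g))) (-U₀))
    (hψℓ : GrowthRate (fun n => matchProb F (p n).ℓ (p n).ℓ) (-K)) :
    ∃ T : ℕ → ℝ, GrowthRate T (2 * S₁ - U₀ - K) ∧
      ∀ᶠ n in atTop, T n ≤ enumCost g (p n) (s n) := by
  rcases le_or_gt (2 * S₁ - U₀ - K) 0 with hC | hC
  · exact exists_growthRate_le_of_nonpos hg hp hr s hC
  have hS₁pos : 0 < S₁ := by linarith
  -- If `V₁` were zero, `S₁` would vanish. Positivity of `U₁` makes the representations numerous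
  -- enough for the second moment bound.
  have hU₁pos : 0 < U₁ := by
    refine lt_of_lt_of_le (lt_of_le_of_ne hV₁ ?_) hV₁U
    rintro rfl
    simp [sizeExponent, h] at hS₁
    linarith
  have hz := orderOf_pos_of_ne_zero hg
  choose a b e₁ e₂ hsplit hroom ha hb he₁ he₂ using fun n => Params.exists_split (hp n)
  have ta := tendsto_half hr.v₁ ha
  have tb := tendsto_half hr.v₁ hb
  have te₁ := tendsto_half hr.ε₂ he₁
  have te₂ := tendsto_half hr.ε₂ he₂
  have hN : GrowthRate (fun n => ((splitVectors g ((p n).k + (p n).ℓ) (a n) (b n)).card : ℝ))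
      S₁ := by
    have h1 := (growthRate_choose_mul_pow hz
      (fun n => (Nat.le_add_right _ _).trans (hroom n).1) hr.halfLength ta).mul
      (growthRate_choose_mul_pow hz
      (fun n => (Nat.le_add_right _ _).trans (hroom n).2) hr.halfLength tb)
    rw [sizeExponent_half, ← hS₁, add_halves] at h1
    refine h1.of_eventuallyEq (Eventually.of_forall fun n => ?_)
    obtain ⟨M, hM⟩ := (hp n).even_length
    rw [card_splitVectors hg (M := M) (by omega),
      show ((p n).k + (p n).ℓ) / 2 = M by omega]
    push_cast
    rfl
  have hrep : GrowthRate (fun n => (numSplitRepresentations (orderOf g)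
      (((p n).k + (p n).ℓ) / 2) (a n) (b n) (e₁ n) (e₂ n) : ℝ)) U₁ := by
    have h1 := (growthRate_representations hz (fun n => (hroom n).1) (fun _ => rfl)
      hr.halfLength ta te₁).mul (growthRate_representations hz (fun n => (hroom n).2)
      (fun _ => rfl) hr.halfLength tb te₂)
    rw [repExponent_half, ← hU₁, add_halves] at h1
    refine h1.of_eventuallyEq (Eventually.of_forall fun n => ?_)
    rw [numSplitRepresentations]
    push_cast
    rfl
  -- The expected number of surviving split representations has exponent `U₁ - U₁ = 0`. The survival
  -- factor is therefore subexponential, whether this number is large or small.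
  have hlam := hrep.mul hψ₁
  rw [add_neg_cancel] at hlam
  have hqpos : (0 : ℝ) < (Fintype.card F : ℝ) ^ 5 := by
    have : 0 < Fintype.card F := Fintype.card_pos
    positivity
  have hden := hlam.add (GrowthRate.const hqpos)
  have hratio : GrowthRate (fun n => ((numSplitRepresentations (orderOf g)
      (((p n).k + (p n).ℓ) / 2) (a n) (b n) (e₁ n) (e₂ n) : ℝ) *
        matchProb F (p n).ℓ ((p n).u₁ g)) ^ 2 / 4 /
      ((numSplitRepresentations (orderOf g)
      (((p n).k + (p n).ℓ) / 2) (a n) (b n) (e₁ n) (e₂ n) : ℝ) *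
        matchProb F (p n).ℓ ((p n).u₁ g) + (Fintype.card F : ℝ) ^ 5) ^ 2) 0 := by
    have h1 := ((hlam.mul hlam).const_mul (show (0 : ℝ) < 1 / 4 by norm_num)).div (hden.mul hden)
    simp only [max_self, add_zero, sub_zero] at h1
    refine h1.of_eventuallyEq (Eventually.of_forall fun n => ?_)
    ring
  refine ⟨_, (hN.mul (hN.const_mul (inv_pos.2 two_pos))).mul ((hψ.mul hψℓ).mul hratio) |> fun h =>
    (show S₁ + S₁ + (-U₀ + -K + 0) = 2 * S₁ - U₀ - K by ring) ▸ h, ?_⟩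
  filter_upwards [hN.eventually_le_half_sub hS₁pos (Fintype.card F),
    (hrep.tendsto_atTop hU₁pos).eventually_ge_atTop (2 * (Fintype.card F : ℝ) ^ 3)] with n h1 h2
  refine le_trans ?_ (le_enumCost_finalCollisions hg (hp n) (s n) (hsplit n) rfl rfl h2)
  have h3 := matchProb_pos (F := F) (p n).ℓ (max ((p n).u₀ g) ((p n).u₁ g))
  have h4 := matchProb_pos (F := F) (p n).ℓ (p n).ℓ
  gcongr

theorem growthRate_enumCost (hg : g ≠ 0) (hp : ∀ n, (p n).Admissible g)
    (hr : HasRates p R L V₀ V₁ V₂ E₁ E₂) (s : (n : ℕ) → Fin (p n).ℓ → F)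
    (hV₁ : 0 ≤ V₁) (hV₀ : 0 ≤ V₀) (hE₁ : 0 ≤ E₁) (hE₂ : 0 ≤ E₂)
    (hroom₁ : V₀ + E₁ ≤ R + L) (hroom₂ : V₁ + E₂ ≤ R + L)
    (hS₁ : S₁ = sizeExponent (Real.logb 2 (orderOf g)) (R + L) V₁)
    (hS₂ : S₂ = sizeExponent (Real.logb 2 (orderOf g)) (R + L) V₂)
    (hU₀ : U₀ = repExponent (Real.logb 2 (orderOf g)) (R + L) V₀ E₁)
    (hU₁ : U₁ = repExponent (Real.logb 2 (orderOf g)) (R + L) V₁ E₂)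
    (hU₁₀ : U₁ ≤ U₀) (hU₀L : U₀ ≤ Real.logb 2 (Fintype.card F) * L) :
    GrowthRate (fun n => enumCost g (p n) (s n)) (max (max (S₂ / 2) (S₂ - U₁))
      (max (2 * S₂ - U₁ - U₀) (2 * S₁ - U₀ - Real.logb 2 (Fintype.card F) * L))) := by
  have hz := orderOf_pos_of_ne_zero hg
  have hZ : 0 ≤ Real.logb 2 (orderOf g) :=
    Real.logb_nonneg one_lt_two (by exact_mod_cast hz)
  have hq : (1 : ℝ) ≤ Fintype.card F := by exact_mod_cast Fintype.card_pos (α := F)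
  set K := Real.logb 2 (Fintype.card F) * L
  have hV₁U : V₁ ≤ U₁ := hU₁ ▸ le_repExponent hZ hE₂ hroom₂
  have hV₀U : V₀ ≤ U₀ := hU₀ ▸ le_repExponent hZ hE₁ hroom₁
  have pu₀ := growthRate_pow_u₀ hg hp hr
  have pu₁ := growthRate_pow_u₁ hg hp hr
  rw [← hU₀] at pu₀
  rw [← hU₁] at pu₁
  have pℓ : GrowthRate (fun n => (Fintype.card F : ℝ) ^ (p n).ℓ) K :=
    growthRate_pow Fintype.card_pos hr.ℓ
  have hψ₁ := growthRate_matchProb pu₁ pℓ (hU₁₀.trans hU₀L)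
  have hψ₀ := growthRate_matchProb pu₀ pℓ hU₀L
  have hψℓ := growthRate_matchProb pℓ pℓ le_rfl
  have hψ₁₀ := growthRate_matchProb ((pu₁.pow_max hq pu₀)) pℓ (max_le (hU₁₀.trans hU₀L) hU₀L)
  -- The assumption `U₁ ≤ U₀` lets the maximum of `u₁` and `u₀` have exponent `U₀`, even if `u₁ >
  -- u₀` for some `n`.
  rw [max_eq_right hU₁₀] at hψ₁₀
  have hψ₀ℓ := growthRate_matchProb ((pu₀.pow_max hq pℓ)) pℓ (max_le hU₀L le_rfl)
  rw [max_eq_right hU₀L] at hψ₀ℓ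
  have hb := growthRate_baseSize hg hp hr
  rw [← hS₂] at hb
  have hbψ : GrowthRate (fun n => ((p n).baseSize g : ℝ) ^ 2 *
      matchProb F (p n).ℓ ((p n).u₁ g)) (S₂ - U₁) := by
    have h1 := (hb.mul hb).mul hψ₁
    rw [add_halves, ← sub_eq_add_neg] at h1
    simpa only [pow_two] using h1
  have hW₁ := growthRate_wellFormed hg
    (fun n => (Nat.le_add_right _ _).trans (hp n).room₂) hr.length hr.v₁
  rw [← hS₁] at hW₁
  have hW₂ := growthRate_wellFormed hg
    (fun n => by have := (hp n).room₂; have := (hp n).weight₂; omega) hr.length hr.v₂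
  rw [← hS₂] at hW₂
  obtain ⟨T₃, hT₃, hT₃'⟩ := exists_growthRate_le_middle hg hp hr s hS₂ (hV₀.trans hV₀U)
    (hV₁.trans hV₁U) hψ₁ hψ₁₀
  obtain ⟨T₄, hT₄, hT₄'⟩ := exists_growthRate_le_final hg hp hr s hS₁ hU₁ hV₁U hV₁
    (hV₀.trans hV₀U) ((hV₀.trans hV₀U).trans hU₀L) hψ₁ (by simpa only [max_comm] using hψ₁₀) hψℓ
  have hupper := (((hb.add hbψ).add ((hW₂.mul hW₂).mul (hψ₁.mul hψ₁₀))).add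
    ((hW₁.mul hW₁).mul (hψ₀.mul hψ₀ℓ))).const_mul
      (show 0 < ((Fintype.card F : ℝ) + 10) ^ 2 by positivity)
  rw [show S₂ + S₂ + (-U₁ + -U₀) = 2 * S₂ - U₁ - U₀ by ring,
    show S₁ + S₁ + (-U₀ + -K) = 2 * S₁ - U₀ - K by ring, max_assoc _ (2 * S₂ - U₁ - U₀)] at hupper
  refine ((hb.max hbψ).max (hT₃.max hT₄)).squeeze hupper ?_ ?_
  · filter_upwards [hT₃', hT₄'] with n h3 h4
    exact max_le (max_le (baseSize_le_enumCost (s n)) (le_enumCost_listC hg (hp n) (s n)))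
      (max_le h3 h4)
  · filter_upwards with n
    have h1 := enumCost_le hg (hp n) (s n)
    simpa only [pow_two] using h1

end Main

end RestrictedBJMM

theorem mainTheorem4 {F : Type*} [Field F] [Fintype F] [DecidableEq F] (g : F) (hg : g ≠ 0)
    (Q Z R L V₀ V₁ V₂ E₁ E₂ S₁ S₂ U₀ U₁ : ℝ)
    (hQ : Q = Real.logb 2 (Fintype.card F)) (hZ : Z = Real.logb 2 (orderOf g))
    (hR : 0 ≤ R) (hL : 0 ≤ L) (hV₀ : 0 ≤ V₀) (hE₁ : 0 ≤ E₁) (hE₂ : 0 ≤ E₂)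
    (hV₁ : V₁ = V₀ / 2 + E₁) (hV₂ : V₂ = V₁ / 2 + E₂)
    (hroom₁ : V₀ + E₁ ≤ R + L) (hroom₂ : V₁ + E₂ ≤ R + L)
    (hcancel : -1 ∈ RestrictedBJMM.errorSet g ∨ (E₁ = 0 ∧ E₂ = 0))
    (hS₁ : S₁ = RestrictedBJMM.sizeExponent Z (R + L) V₁)
    (hS₂ : S₂ = RestrictedBJMM.sizeExponent Z (R + L) V₂)
    (hU₀ : U₀ = RestrictedBJMM.repExponent Z (R + L) V₀ E₁)
    (hU₁ : U₁ = RestrictedBJMM.repExponent Z (R + L) V₁ E₂)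
    (hU₁₀ : U₁ ≤ U₀) (hU₀L : U₀ ≤ Q * L) :
    (∃ p : ℕ → RestrictedBJMM.Params,
      (∀ n, (p n).Admissible g) ∧ RestrictedBJMM.HasRates p R L V₀ V₁ V₂ E₁ E₂) ∧
    ∀ p : ℕ → RestrictedBJMM.Params, (∀ n, (p n).Admissible g) →
      RestrictedBJMM.HasRates p R L V₀ V₁ V₂ E₁ E₂ →
      Tendsto (fun n : ℕ => Real.logb 2
        ((RestrictedBJMM.wellFormed g ((p n).k + (p n).ℓ) (p n).v₁).card : ℝ) / n)
        atTop (𝓝 S₁) ∧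
      Tendsto (fun n : ℕ => Real.logb 2
        ((RestrictedBJMM.wellFormed g ((p n).k + (p n).ℓ) (p n).v₂).card : ℝ) / n)
        atTop (𝓝 S₂) ∧
      Tendsto (fun n : ℕ => Q * (((p n).u₀ g : ℝ) / n)) atTop (𝓝 U₀) ∧
      Tendsto (fun n : ℕ => Q * (((p n).u₁ g : ℝ) / n)) atTop (𝓝 U₁) ∧
      ∀ s : (n : ℕ) → Fin (p n).ℓ → F,
        Tendsto (fun n : ℕ => Real.logb 2 (RestrictedBJMM.enumCost g (p n) (s n)) / n) atTop
          (𝓝 (max (max (S₂ / 2) (S₂ - U₁))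
            (max (2 * S₂ - U₁ - U₀) (2 * S₁ - U₀ - Q * L)))) := by
  subst hQ hZ
  refine ⟨RestrictedBJMM.exists_params g hR hL hV₀ hE₁ hE₂ hV₁ hV₂ hroom₁ hroom₂ hcancel,
    fun p hp hr => ⟨?_, ?_, ?_, ?_, fun s => ?_⟩⟩
  · rw [hS₁]
    exact (RestrictedBJMM.growthRate_wellFormed hg
      (fun n => (Nat.le_add_right _ _).trans (hp n).room₂) hr.length hr.v₁).2
  · rw [hS₂]
    exact (RestrictedBJMM.growthRate_wellFormed hg
      (fun n => by have := (hp n).room₂; have := (hp n).weight₂; omega) hr.length hr.v₂).2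
  · rw [hU₀]
    exact (RestrictedBJMM.growthRate_pow_u₀ hg hp hr).tendsto_logb_mul
  · rw [hU₁]
    exact (RestrictedBJMM.growthRate_pow_u₁ hg hp hr).tendsto_logb_mul
  · exact (RestrictedBJMM.growthRate_enumCost hg hp hr s (by rw [hV₁]; positivity) hV₀ hE₁ hE₂
      hroom₁ hroom₂ hS₁ hS₂ hU₀ hU₁ hU₁₀ hU₀L).2
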